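/- For an oriented link diagram $D$, let $H_D(v,z)\in\mathbb Z[v^{\pm1},z^{\pm1}]$ denote the framed Homfly polynomial: the regular isotopy invariant determined by the skein relation $H_{D_+}-H_{D_-}=z\,H_{D_0}$ (where $D_+$, $D_-$, $D_0$ differ only at one place, where they have a positive crossing, a negative crossing, and the oriented smoothing, respectively), by the kink relations $H_{D'}=v^{-1}H_D$ and $H_{D''}=v\,H_D$ when $D'$, respectively $D''$, arises from $D$ by adding a kink with a positive, respectively negative, crossing, and by the normalization $H_{\bigcirc}=1$ for the crossingless diagram of the unknot, with either orientation. Let $n\ge 1$ and let $\beta$ be a braid on $n$ strands. Let $\widehat\beta$ denote the closed braid diagram that is the union of a diagram of $\beta$ (with all strands oriented from left to right) and $n$ disjoint simple curves above it, and let $\Delta=(\sigma_1\cdots\sigma_{n-1})(\sigma_1\cdots\sigma_{n-2})\cdots(\sigma_1\sigma_2)\,\sigma_1$ be the Garside half twist on $n$ strands, where the standard generators $\sigma_i$ are positive crossings. Then $H_{\widehat\beta}$ and $H_{\widehat{\beta\Delta^2}}$ are well defined, and $$\text{the coefficient of } v^{-n+1} \text{ in } H_{\widehat\beta}(v,z)\;=\;(-1)^{n-1}\cdot\text{the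 coefficient of } v^{n-1} \text{ in } H_{\widehat{\beta\Delta^2}}(v,z),$$ as Laurent polynomials in $z$, for any choice of braid words representing $\beta$ and $\beta\Delta^2$. -/

import Mathlib

set_option maxSynthPendingDepth 3

noncomputable section

namespace FramedHomfly

/-! ## Oriented link diagrams in sliced form

A diagram in the plane is read from left to right, as a finite sequence of slices, each of which
contains exactly one elementary piece. A vertical line between two slices meets the diagram in
finitely many strands; they are listed from top to bottom, and `true` stands for a strand that is
oriented from left to right, `false` for one that is oriented from right to left. -/

/-- The elementary pieces.
`cup b` is the arc `⊂`, which opens to the right, and whose upper end has orientation `b`.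
`cap b` is the arc `⊃`, which opens to the left, and whose upper end has orientation `b`.
`cross true` is the positive and `cross false` the negative crossing of two neighbouring strands
that are both oriented from left to right. (In the positive crossing the strand that runs from the
upper left to the lower right passes over the other one, in the negative crossing it passes
under.) Every crossing of an oriented diagram can be rotated into this position. -/
inductive Piece
  | cup (b : Bool)
  | cap (b : Bool)
  | cross (positive : Bool)

/-- The strands at the left end of a piece. -/
def Piece.dom : Piece → List Bool
  | .cup _ => []
  | .cap b => [b, !b]
  | .cross _ => [true, true]

/-- The strands at the right end of a piece. -/
def Piece.cod : Piece → List Bool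
  | .cup b => [b, !b]
  | .cap _ => []
  | .cross _ => [true, true]

/-- A slice: one elementary piece with horizontal strands above it and below it. -/
structure Slice where
  above : List Bool
  piece : Piece
  below : List Bool

/-- The strands at the left end of a slice. -/
def Slice.dom (x : Slice) : List Bool := x.above ++ x.piece.dom ++ x.below

/-- The strands at the right end of a slice. -/
def Slice.cod (x : Slice) : List Bool := x.above ++ x.piece.cod ++ x.below

/-- `IsTangle s w t`: the slices of `w` fit together to an oriented tangle diagram with left end
`s` and right end `t`. -/
def IsTangle : List Bool → List Slice → List Bool → Prop
  | s, [], t => s = t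
  | s, x :: w, t => s = x.dom ∧ IsTangle x.cod w t

/-- Oriented link diagrams: the tangle diagrams without end points. -/
def LinkDiagram : Type := {w : List Slice // IsTangle [] w []}

/-- The slices of a link diagram, from left to right. -/
def LinkDiagram.slices (D : LinkDiagram) : List Slice := D.1

/-- The diagram `w` with horizontal strands `A` added above it and `B` added below it. -/
def whisker (A : List Bool) (w : List Slice) (B : List Bool) : List Slice :=
  w.map fun x => ⟨A ++ x.above, x.piece, x.below ++ B⟩

/-- `D` arises when the tangle diagram `a` is placed into a certain disk, `D'` when `b` is placed
into the same disk. (Here the disk is given by the rest of the diagram: `u` on the left, `w` on the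
right, the strands `A` above and `B` below.) -/
def DifferBy (a b : List Slice) (D D' : LinkDiagram) : Prop :=
  ∃ (u w : List Slice) (A B : List Bool),
    D.slices = u ++ whisker A a B ++ w ∧ D'.slices = u ++ whisker A b B ++ w

/-- A crossing of two strands oriented from right to left, obtained from a crossing of sign `c` of
two strands oriented from left to right by a half turn: here the turn is clockwise. -/
def halfTurnClockwise (c : Bool) : List Slice :=
  [⟨[], .cup false, [false, false]⟩, ⟨[false], .cup false, [true, false, false]⟩,
   ⟨[false, false], .cross c, [false, false]⟩,
   ⟨[false, false, true], .cap true, [false]⟩, ⟨[false, false], .cap true, []⟩]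

/-- The same crossing, obtained by a counterclockwise half turn. -/
def halfTurnCounterclockwise (c : Bool) : List Slice :=
  [⟨[false, false], .cup true, []⟩, ⟨[false, false, true], .cup true, [false]⟩,
   ⟨[false, false], .cross c, [false, false]⟩,
   ⟨[false], .cap false, [true, false, false]⟩, ⟨[], .cap false, [false, false]⟩]

/-- A crossing of two strands with opposite orientations, obtained by a quarter turn: the strand
oriented to the right runs from the lower left to the upper right. -/
def quarterTurnUp (c : Bool) : List Slice :=
  [⟨[false, true], .cup true, []⟩, ⟨[false], .cross c, [false]⟩, ⟨[], .cap false, [true, false]⟩]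

/-- A crossing of two strands with opposite orientations, obtained by a quarter turn: the strand
oriented to the right runs from the upper left to the lower right. -/
def quarterTurnDown (c : Bool) : List Slice :=
  [⟨[], .cup false, [true, false]⟩, ⟨[false], .cross c, [false]⟩, ⟨[false, true], .cap true, []⟩]

/-- The local moves that generate regular isotopy of oriented sliced diagrams: isotopies of the
plane, and the Reidemeister moves of types II and III (and none of type I). -/
inductive RegularMove : List Slice → List Slice → Prop
  /-- two pieces, one far above the other, exchange their horizontal order -/
  | exchange (g h : Piece) (m : List Bool) :
      RegularMove [⟨[], g, m ++ h.dom⟩, ⟨g.cod ++ m, h, []⟩]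
        [⟨g.dom ++ m, h, []⟩, ⟨[], g, m ++ h.cod⟩]
  /-- a zigzag is pulled straight -/
  | zigzag_left (b : Bool) : RegularMove [⟨[b], .cup (!b), []⟩, ⟨[], .cap b, [b]⟩] []
  /-- a zigzag is pulled straight -/
  | zigzag_right (b : Bool) : RegularMove [⟨[], .cup b, [b]⟩, ⟨[b], .cap (!b), []⟩] []
  /-- a crossing is rotated by a full turn -/
  | full_turn (c : Bool) : RegularMove (halfTurnClockwise c)
        (halfTurnCounterclockwise c)
  /-- the second Reidemeister move for two strands with the same orientation -/
  | reidemeister_two (c : Bool) : RegularMove [⟨[], .cross c, []⟩, ⟨[], .cross (!c), []⟩] []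
  /-- the second Reidemeister move for two strands with opposite orientations -/
  | reidemeister_two_opp (c : Bool) :
      RegularMove (quarterTurnUp c ++ quarterTurnDown (!c)) []
  /-- the second Reidemeister move for two strands with opposite orientations -/
  | reidemeister_two_opp' (c : Bool) :
      RegularMove (quarterTurnDown c ++ quarterTurnUp (!c)) []
  /-- the third Reidemeister move -/
  | reidemeister_three (c : Bool) :
      RegularMove
        [⟨[], .cross c, [true]⟩, ⟨[true], .cross c, []⟩, ⟨[], .cross c, [true]⟩]
        [⟨[true], .cross c, []⟩, ⟨[], .cross c, [true]⟩, ⟨[true], .cross c, []⟩]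

/-- A strand with a kink below it whose crossing has sign `c`. -/
def kinkBelow (c : Bool) : List Slice :=
  [⟨[true], .cup true, []⟩, ⟨[], .cross c, [false]⟩, ⟨[true], .cap true, []⟩]

/-- A strand with a kink above it whose crossing has sign `c`. -/
def kinkAbove (c : Bool) : List Slice :=
  [⟨[], .cup false, [true]⟩, ⟨[false], .cross c, []⟩, ⟨[], .cap false, [true]⟩]

/-- The crossingless diagram of the unknot, with either orientation. -/
def unknot (b : Bool) : LinkDiagram :=
  ⟨[⟨[], .cup b, []⟩, ⟨[], .cap b, []⟩], by
    simp [IsTangle, Slice.dom, Slice.cod, Piece.dom, Piece.cod]⟩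

/-! ## The framed Homfly polynomial -/

/-- Integer Laurent polynomials in `v` and `z`, written as Laurent polynomials in `v` whose
coefficients are Laurent polynomials in `z`. -/
abbrev Poly : Type := LaurentPolynomial (LaurentPolynomial ℤ)

/-- The power `v ^ k`. -/
def v (k : ℤ) : Poly := LaurentPolynomial.T k

/-- The indeterminate `z`. -/
def z : Poly := LaurentPolynomial.C (LaurentPolynomial.T 1)

/-- The formal linear combination consisting of the single diagram `D`. -/
def single (D : LinkDiagram) : LinkDiagram →₀ Poly := Finsupp.single D 1

/-- The defining relations of the framed Homfly polynomial, as linear combinations of diagrams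
that have to vanish. -/
inductive SkeinRelation : (LinkDiagram →₀ Poly) → Prop
  /-- invariance under regular isotopy -/
  | regular {a b : List Slice} {D D' : LinkDiagram} (hab : RegularMove a b)
      (h : DifferBy a b D D') : SkeinRelation (single D - single D')
  /-- `H(positive crossing) - H(negative crossing) = z H(smoothed crossing)` -/
  | skein {P N S : LinkDiagram}
      (h : ∃ (u w : List Slice) (A B : List Bool),
        P.slices = u ++ whisker A [⟨[], .cross true, []⟩] B ++ w ∧
        N.slices = u ++ whisker A [⟨[], .cross false, []⟩] B ++ w ∧
        S.slices = u ++ w) : SkeinRelation (single P - single N - z • single S)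
  /-- removing a positive kink: `H(kink) = v⁻¹ H(strand)` -/
  | kink_pos {K D : LinkDiagram}
      (h : DifferBy (kinkBelow true) [] K D ∨ DifferBy (kinkAbove true) [] K D) :
      SkeinRelation (single K - v (-1) • single D)
  /-- removing a negative kink: `H(kink) = v H(strand)` -/
  | kink_neg {K D : LinkDiagram}
      (h : DifferBy (kinkBelow false) [] K D ∨ DifferBy (kinkAbove false) [] K D) :
      SkeinRelation (single K - v 1 • single D)
  /-- the crossingless unknot diagrams of both orientations have the same value -/
  | unknot : SkeinRelation (single (unknot true) - single (unknot false))

/-- The module of all linear combinations of diagrams modulo the defining relations. -/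
abbrev SkeinModule : Type := (LinkDiagram →₀ Poly) ⧸ Submodule.span Poly {x | SkeinRelation x}

/-- The class of a diagram in the skein module. -/
def skeinClass (D : LinkDiagram) : SkeinModule := Submodule.Quotient.mk (single D)

/-- The defining relations evaluate the diagram `D` to the polynomial `h`, when the crossingless
unknot diagram is given the value `1`. -/
def IsFramedHomfly (D : LinkDiagram) (h : Poly) : Prop :=
  skeinClass D = h • skeinClass (unknot true)

open Classical in
/-- The framed Homfly polynomial `H_D`: the polynomial to which the defining relations evaluate
`D`. -/
def framedHomfly (D : LinkDiagram) : Poly :=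
  if h : ∃ p, IsFramedHomfly D p then h.choose else 0

/-- If `F` is a function on diagrams that satisfies the defining relations and is normalized to `1`
on the crossingless unknot diagram, then `F D` is the polynomial to which they evaluate `D`. -/
theorem IsFramedHomfly.eq_of_relations {D : LinkDiagram} {h : Poly} (hD : IsFramedHomfly D h)
    (F : LinkDiagram → Poly) (hF : ∀ x, SkeinRelation x → x.sum (fun E c => c * F E) = 0)
    (h1 : F (unknot true) = 1) : F D = h := by
  let L : (LinkDiagram →₀ Poly) →ₗ[Poly] Poly := Finsupp.linearCombination Poly F
  have hL : Submodule.span Poly {x | SkeinRelation x} ≤ LinearMap.ker L := by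
    rw [Submodule.span_le]
    intro x hx
    have := hF x hx
    simpa [L, Finsupp.linearCombination_apply] using this
  have h2 := congrArg (Submodule.liftQ _ L hL) hD
  rw [map_smul] at h2
  simpa [skeinClass, single, L, h1] using h2

/-! ## Braids and their closures -/

/-- Braid words on `n` strands: the letter `(i, true)` is the generator `σ_{i+1}`, a positive
crossing with `i` strands above it; the letter `(i, false)` is its inverse. -/
abbrev BraidWord (n : ℕ) : Type := List (Fin (n - 1) × Bool)

/-- The relations of the braid group. -/
def braidRelations (n : ℕ) : Set (FreeGroup (Fin (n - 1))) :=
  {r | (∃ i j : Fin (n - 1), i.val + 1 < j.val ∧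
          r = (FreeGroup.of i * FreeGroup.of j) * (FreeGroup.of j * FreeGroup.of i)⁻¹) ∨
       (∃ i j : Fin (n - 1), i.val + 1 = j.val ∧
          r = (FreeGroup.of i * FreeGroup.of j * FreeGroup.of i) *
            (FreeGroup.of j * FreeGroup.of i * FreeGroup.of j)⁻¹)}

/-- The braid group on `n` strands. -/
abbrev BraidGroup (n : ℕ) : Type := PresentedGroup (braidRelations n)

/-- The standard generators of the braid group. -/
def sigma {n : ℕ} (i : Fin (n - 1)) : BraidGroup n := PresentedGroup.of i

/-- The braid represented by a braid word. -/
def BraidWord.toBraid {n : ℕ} (w : BraidWord n) : BraidGroup n :=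
  (w.map fun x => if x.2 then sigma x.1 else (sigma x.1)⁻¹).prod

/-- The product `σ_1 σ_2 ⋯ σ_k`. -/
def ascending (n k : ℕ) : BraidGroup n :=
  (((List.finRange (n - 1)).filter fun i => i.val < k).map sigma).prod

/-- The Garside braid (positive half twist)
`Δ = (σ_1 ⋯ σ_{n-1}) (σ_1 ⋯ σ_{n-2}) ⋯ (σ_1 σ_2) σ_1`. -/
def garside (n : ℕ) : BraidGroup n :=
  ((List.range n).map fun k => ascending n (n - 1 - k)).prod

/-- The `k` outermost of the closing arcs, at their left ends. -/
def openArcs (k : ℕ) : List Slice :=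
  (List.range k).map fun j => ⟨List.replicate j false, .cup false, List.replicate j true⟩

/-- The `k` outermost of the closing arcs, at their right ends. -/
def closeArcs (k : ℕ) : List Slice :=
  ((List.range k).map fun j =>
    ⟨List.replicate j false, .cap false, List.replicate j true⟩).reverse

/-- The part of the closed diagram that contains the braid, with the closing arcs above it. -/
def braidPart {n : ℕ} (w : BraidWord n) : List Slice :=
  w.map fun x => ⟨List.replicate n false ++ List.replicate x.1.val true, .cross x.2,
    List.replicate (n - 2 - x.1.val) true⟩

theorem IsTangle.append {s t r : List Bool} {a b : List Slice} (ha : IsTangle s a t)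
    (hb : IsTangle t b r) : IsTangle s (a ++ b) r := by
  induction a generalizing s with
  | nil => cases ha; exact hb
  | cons x a ih => exact ⟨ha.1, ih ha.2⟩

theorem isTangle_openArcs (k : ℕ) :
    IsTangle [] (openArcs k) (List.replicate k false ++ List.replicate k true) := by
  induction k with
  | zero => rfl
  | succ k ih =>
    have : openArcs (k + 1) = openArcs k ++
        [⟨List.replicate k false, .cup false, List.replicate k true⟩] := by
      simp [openArcs, List.range_succ]
    rw [this]
    refine ih.append ⟨by simp [Slice.dom, Piece.dom], ?_⟩
    rw [List.replicate_succ' (a := false), List.replicate_succ (a := true)]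
    simp [IsTangle, Slice.cod, Piece.cod]

theorem isTangle_closeArcs (k : ℕ) :
    IsTangle (List.replicate k false ++ List.replicate k true) (closeArcs k) [] := by
  induction k with
  | zero => rfl
  | succ k ih =>
    have : closeArcs (k + 1) =
        ⟨List.replicate k false, .cap false, List.replicate k true⟩ :: closeArcs k := by
      simp [closeArcs, List.range_succ]
    rw [this, List.replicate_succ' (a := false), List.replicate_succ (a := true)]
    refine ⟨by simp [Slice.dom, Piece.dom], ?_⟩
    simpa [Slice.cod, Piece.cod] using ih

theorem isTangle_braidPart {n : ℕ} (w : BraidWord n) :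
    IsTangle (List.replicate n false ++ List.replicate n true) (braidPart w)
      (List.replicate n false ++ List.replicate n true) := by
  induction w with
  | nil => rfl
  | cons x w ih =>
    have hx := x.1.isLt
    have e : List.replicate n true = List.replicate x.1.val true ++ [true, true] ++
        List.replicate (n - 2 - x.1.val) true := by
      have : [true, true] = List.replicate 2 true := rfl
      rw [this, List.replicate_append_replicate, List.replicate_append_replicate]
      congr 1
      omega
    refine ⟨?_, ?_⟩
    · rw [e]; simp [Slice.dom, Piece.dom]
    · have : IsTangle (List.replicate n false ++ List.replicate n true) (braidPart w)
        (List.replicate n false ++ List.replicate n true) := ih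
      rw [e] at this ⊢
      simpa [Slice.cod, Piece.cod, braidPart] using this

/-- The closure of a braid word: its strands run from left to right, and the corresponding end
points are joined by `n` disjoint simple arcs above the braid. -/
def BraidWord.closure {n : ℕ} (w : BraidWord n) : LinkDiagram :=
  ⟨openArcs n ++ braidPart w ++ closeArcs n,
    ((isTangle_openArcs n).append (isTangle_braidPart w)).append (isTangle_closeArcs n)⟩

end FramedHomfly

end

/-! Well-definedness. A braid enters its closure's skein class only through the group element, since
the moves of types II and III and planar exchanges realize the braid relations. The class of a
crossing satisfies the quadratic Hecke relation σ - σ⁻¹ = z, and the Hecke algebra on k + 2 strands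
is spanned by elements that avoid σ₁ and elements that contain it once. Adding a strand above a
braid (`shiftHom`) identifies the braids on k + 1 strands with the part that avoids σ₁. A braid with
one σ₁^{±1} closes to a kink, so the strand can be removed at the cost of v^{∓1}; a braid without σ₁
closes to a diagram with an extra loop, which costs z⁻¹(v⁻¹ - v). By induction every closed braid is
a multiple of the unknot (`closureClass_mem_span`). The multiple is unique because the gl_N state
sums, for all N ≥ 1 and q > 1, are models of the relations at v = q^{-N}, z = q - q⁻¹, and a Laurent
polynomial that vanishes at all these points is zero (`eq_zero_of_smul_unknot`).

The coefficients. The same induction gives the bound |degree in v| ≤ k for k + 1 strands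
(`coeff_braidHomfly_eq_zero`). Put F(β) = bottom coefficient of β minus (±1) times the top
coefficient of βΔ². This F is again a function on the Hecke algebra, so it suffices to test it on
braids x without σ₁ and on braids xσ₁⁻¹y with x, y free of σ₁ (`coeff_braidHomfly_mul_fullTwist`).
Write Δ² = δAδ, where δ is the half twist of the lower strands and A = σ₁⋯σ_{k+1}σ_{k+1}⋯σ₁ pulls
the first strand around the others; A commutes with the lower strands.

For xσ₁⁻¹y the factor v of the negative kink makes the bottom coefficient vanish. After
multiplication by Δ² the letter σ₁⁻¹ cancels against the beginning of A, leaving a single σ₁; the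
factor v⁻¹ of the positive kink then makes the top coefficient vanish. For x itself, βΔ² becomes
xδ²A. Resolving the squares inside A one after the other changes the top coefficient only by braids
with a single σ₁, which contribute nothing (`coeff_top_ascProd_mul_descProd`), so A can be dropped.
The loop factor z⁻¹(v⁻¹ - v) then reduces both coefficients to one strand fewer, with opposite
signs; this is the origin of (-1)^{n-1}. -/

/-! ## Products of braid generators in a group -/

namespace FramedHomfly

variable {G : Type*} [Group G]

/-- The first `m` terms of the sequence `t` satisfy the relations of the standard generators of a
braid group. -/
structure IsBraidSequence (t : ℕ → G) (m : ℕ) : Prop where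
  commute : ∀ i j, i + 1 < j → j < m → Commute (t i) (t j)
  braid : ∀ i, i + 1 < m → t i * t (i + 1) * t i = t (i + 1) * t i * t (i + 1)

/-- The product `t 0 * t 1 * ⋯ * t (m - 1)`. -/
def ascProd (t : ℕ → G) : ℕ → G
  | 0 => 1
  | m + 1 => ascProd t m * t m

/-- The product `t (m - 1) * ⋯ * t 1 * t 0`. -/
def descProd (t : ℕ → G) : ℕ → G
  | 0 => 1
  | m + 1 => t m * descProd t m

/-- The half twist on `m` strands. -/
def halfTwist (t : ℕ → G) : ℕ → G
  | 0 => 1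
  | m + 1 => ascProd t m * halfTwist t m

theorem ascProd_succ' (t : ℕ → G) (m : ℕ) :
    ascProd t (m + 1) = t 0 * ascProd (fun i => t (i + 1)) m := by
  induction m with
  | zero => simp [ascProd]
  | succ m ih => rw [ascProd, ih, ascProd, mul_assoc]

theorem descProd_succ' (t : ℕ → G) (m : ℕ) :
    descProd t (m + 1) = descProd (fun i => t (i + 1)) m * t 0 := by
  induction m with
  | zero => simp [descProd]
  | succ m ih => rw [descProd, ih, descProd, mul_assoc]

/-! ### Half twists and full twists from the braid relations. -/

namespace IsBraidSequence

variable {t : ℕ → G} {M : ℕ}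

theorem mono (h : IsBraidSequence t M) {m : ℕ} (hm : m ≤ M) : IsBraidSequence t m :=
  ⟨fun i j hij hj => h.commute i j hij (hj.trans_le hm), fun i hi => h.braid i (hi.trans_le hm)⟩

/-- Strands are added at the top of a braid, whereas the spanning argument for the Hecke algebra
peels off the last generator. Reversing the numbering reconciles the two. -/
theorem reverse (h : IsBraidSequence t M) : IsBraidSequence (fun j => t (M - 1 - j)) M := by
  refine ⟨fun i j hij hj => (h.commute _ _ ?_ ?_).symm, fun i hi => ?_⟩
  · omega
  · omega
  · have := h.braid (M - 1 - (i + 1)) (by omega)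
    rw [show M - 1 - (i + 1) + 1 = M - 1 - i by omega] at this
    exact this.symm

theorem commute_ascProd (h : IsBraidSequence t M) {j m : ℕ} (hm : m < j) (hj : j < M) :
    Commute (t j) (ascProd t m) := by
  induction m with
  | zero => exact Commute.one_right _
  | succ m ih => exact (ih (by omega)).mul_right (h.commute m j hm hj).symm

theorem commute_descProd (h : IsBraidSequence t M) {j m : ℕ} (hm : m < j) (hj : j < M) :
    Commute (t j) (descProd t m) := by
  induction m with
  | zero => exact Commute.one_right _
  | succ m ih => exact (h.commute m j hm hj).symm.mul_right (ih (by omega))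

theorem commute_halfTwist (h : IsBraidSequence t M) {j m : ℕ} (hm : m ≤ j) (hj : j < M) :
    Commute (t j) (halfTwist t m) := by
  induction m with
  | zero => exact Commute.one_right _
  | succ m ih => exact (h.commute_ascProd (by omega) hj).mul_right (ih (by omega))

/-- The letter `t (i + 1)` commutes past the factors before `t i`, the braid relation turns it into
`t i` on the other side of `t i * t (i + 1)`, and the later factors commute with `t i`. Conjugation
by the ascending product is thus a shift of generators. -/
theorem succ_mul_ascProd (h : IsBraidSequence t M) {i m : ℕ} (hi : i + 1 < m) (hm : m ≤ M) :
    t (i + 1) * ascProd t m = ascProd t m * t i := by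
  induction m with
  | zero => omega
  | succ m ih =>
    rcases Nat.lt_or_ge (i + 1) m with hlt | hge
    · rw [ascProd, ← mul_assoc, ih hlt (by omega), mul_assoc,
        (h.commute i m hlt (by omega)).eq, mul_assoc]
    · obtain rfl : m = i + 1 := by omega
      rw [ascProd, ascProd]
      calc t (i + 1) * (ascProd t i * t i * t (i + 1))
          = (t (i + 1) * ascProd t i) * t i * t (i + 1) := by group
        _ = ascProd t i * (t (i + 1) * t i * t (i + 1)) := by
            rw [(h.commute_ascProd (Nat.lt_succ_self i) (by omega)).eq]; group
        _ = _ := by rw [← h.braid i (by omega)]; group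

theorem descProd_mul_succ (h : IsBraidSequence t M) {i m : ℕ} (hi : i + 1 < m) (hm : m ≤ M) :
    descProd t m * t (i + 1) = t i * descProd t m := by
  induction m with
  | zero => omega
  | succ m ih =>
    rcases Nat.lt_or_ge (i + 1) m with hlt | hge
    · rw [descProd, mul_assoc, ih hlt (by omega), ← mul_assoc,
        ← (h.commute i m hlt (by omega)).eq, mul_assoc]
    · obtain rfl : m = i + 1 := by omega
      rw [descProd, descProd]
      calc t (i + 1) * (t i * descProd t i) * t (i + 1)
          = t (i + 1) * t i * (descProd t i * t (i + 1)) := by group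
        _ = (t (i + 1) * t i * t (i + 1)) * descProd t i := by
            rw [← (h.commute_descProd (Nat.lt_succ_self i) (by omega)).eq]; group
        _ = _ := by rw [← h.braid i (by omega)]; group

theorem ascProd_shift_mul (h : IsBraidSequence t M) {m : ℕ} (hm : m ≤ M) {r : ℕ} (hr : r < m) :
    ascProd (fun i => t (i + 1)) r * ascProd t m = ascProd t m * ascProd t r := by
  induction r with
  | zero => simp [ascProd]
  | succ r ih =>
    rw [ascProd, mul_assoc, h.succ_mul_ascProd hr hm, ← mul_assoc, ih (by omega), mul_assoc,
      ascProd]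

theorem mul_ascProd_shift (h : IsBraidSequence t M) {m : ℕ} (hm : m ≤ M) {r : ℕ} (hr : r < m) :
    descProd t m * ascProd (fun i => t (i + 1)) r = ascProd t r * descProd t m := by
  induction r with
  | zero => simp [ascProd]
  | succ r ih =>
    rw [ascProd, ← mul_assoc, ih (by omega), mul_assoc, h.descProd_mul_succ hr hm, ← mul_assoc,
      ascProd]

theorem halfTwist_shift_mul (h : IsBraidSequence t M) {m : ℕ} (hm : m ≤ M) {r : ℕ} (hr : r ≤ m) :
    halfTwist (fun i => t (i + 1)) r * ascProd t m = ascProd t m * halfTwist t r := by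
  induction r with
  | zero => simp [halfTwist]
  | succ r ih =>
    rw [halfTwist, mul_assoc, ih (by omega), ← mul_assoc, h.ascProd_shift_mul hm hr, mul_assoc,
      halfTwist]

theorem mul_halfTwist_shift (h : IsBraidSequence t M) {m : ℕ} (hm : m ≤ M) {r : ℕ} (hr : r ≤ m) :
    descProd t m * halfTwist (fun i => t (i + 1)) r = halfTwist t r * descProd t m := by
  induction r with
  | zero => simp [halfTwist]
  | succ r ih =>
    rw [halfTwist, ← mul_assoc, h.mul_ascProd_shift hm hr, mul_assoc, ih (by omega), ← mul_assoc,
      halfTwist]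

/-- A second recursion for the half twist, with the new strand split off on the right. The full
twist is computed by using one recursion for each of its two factors. -/
theorem halfTwist_succ_eq_mul_descProd (h : IsBraidSequence t M) {m : ℕ} (hm : m ≤ M) :
    halfTwist t (m + 1) = halfTwist t m * descProd t m := by
  induction m with
  | zero => simp [halfTwist, ascProd, descProd]
  | succ m ih =>
    calc halfTwist t (m + 2) = ascProd t m * t m * halfTwist t (m + 1) := rfl
      _ = ascProd t m * (t m * halfTwist t m) * descProd t m := by
          rw [ih (by omega)]; group
      _ = (ascProd t m * halfTwist t m) * (t m * descProd t m) := by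
          rw [(h.commute_halfTwist le_rfl (by omega)).eq]; group
      _ = _ := rfl

/-- The full twist in terms of the full twist on all strands but the first. -/
theorem halfTwist_sq (h : IsBraidSequence t M) {m : ℕ} (hm : m ≤ M) :
    halfTwist t (m + 1) ^ 2 = halfTwist (fun i => t (i + 1)) m * (ascProd t m * descProd t m) *
      halfTwist (fun i => t (i + 1)) m := by
  have h1 : halfTwist t (m + 1) = halfTwist (fun i => t (i + 1)) m * ascProd t m := by
    rw [h.halfTwist_shift_mul hm le_rfl, halfTwist]
  have h2 : halfTwist t (m + 1) = descProd t m * halfTwist (fun i => t (i + 1)) m := by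
    rw [h.mul_halfTwist_shift hm le_rfl, h.halfTwist_succ_eq_mul_descProd hm]
  calc halfTwist t (m + 1) ^ 2 = halfTwist t (m + 1) * halfTwist t (m + 1) := sq _
    _ = halfTwist (fun i => t (i + 1)) m * ascProd t m *
        (descProd t m * halfTwist (fun i => t (i + 1)) m) := by rw [← h2, ← h1]
    _ = _ := by group

/-- The first strand, pulled once around all the others, commutes with the braids of the others. -/
theorem commute_ascProd_mul_descProd (h : IsBraidSequence t M) {m : ℕ} (hm : m ≤ M) {i : ℕ}
    (hi : i + 1 < m) : Commute (t (i + 1)) (ascProd t m * descProd t m) := by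
  rw [Commute, SemiconjBy, ← mul_assoc, h.succ_mul_ascProd hi hm, mul_assoc, mul_assoc,
    h.descProd_mul_succ hi hm]

/-- Two words for the same band joining the first strand to a distant one. The second word contains
`t 0` only once, so that it closes up to a stabilization. -/
theorem ascProd_mul_mul_descProd (h : IsBraidSequence t M) {m : ℕ} (hm : m < M) :
    ascProd t m * t m * descProd t m =
      descProd (fun i => t (i + 1)) m * t 0 * ascProd (fun i => t (i + 1)) m := by
  induction m with
  | zero => simp [ascProd, descProd]
  | succ m ih =>
    calc ascProd t (m + 1) * t (m + 1) * descProd t (m + 1)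
        = ascProd t m * (t m * t (m + 1) * t m) * descProd t m := by
          rw [ascProd, descProd]; group
      _ = ascProd t m * t (m + 1) * t m * (t (m + 1) * descProd t m) := by
          rw [h.braid m hm]; group
      _ = t (m + 1) * (ascProd t m * t m * descProd t m) * t (m + 1) := by
          rw [(h.commute_descProd (Nat.lt_succ_self m) hm).eq,
            ← (h.commute_ascProd (Nat.lt_succ_self m) hm).eq]; group
      _ = _ := by rw [ih (by omega), ascProd, descProd]; group

end IsBraidSequence

/-! ## Functions on a group that factor through the Hecke algebra -/

variable {R : Type*} [CommRing R] {M : Type*} [AddCommGroup M] [Module R M]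

/-- The linear extension of `F` respects the quadratic relations of the Hecke algebra for the
elements `s 0, …, s (m - 1)`. -/
def IsHeckeFunction (z : R) (s : ℕ → G) (m : ℕ) (F : G → M) : Prop :=
  ∀ i < m, ∀ x y, F (x * s i * y) - F (x * (s i)⁻¹ * y) = z • F (x * y)

namespace IsHeckeFunction

variable {z : R} {s : ℕ → G} {m : ℕ} {F : G → M}

theorem mono (h : IsHeckeFunction z s m F) {k : ℕ} (hk : k ≤ m) : IsHeckeFunction z s k F :=
  fun i hi => h i (hi.trans_le hk)

theorem translate (h : IsHeckeFunction z s m F) (a b : G) :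
    IsHeckeFunction z s m fun g => F (a * g * b) := fun i hi x y => by
  simpa [mul_assoc] using h i hi (a * x) (y * b)

theorem map_sq (h : IsHeckeFunction z s m F) {i : ℕ} (hi : i < m) (x y : G) :
    F (x * (s i * s i) * y) = F (x * y) + z • F (x * s i * y) := by
  have := h i hi (x * s i) y
  rw [sub_eq_iff_eq_add] at this
  rw [← mul_assoc, this]
  simp [add_comm]

end IsHeckeFunction

/-- The subgroup generated by `s 0, …, s (m - 1)`. -/
def initialSubgroup (s : ℕ → G) (m : ℕ) : Subgroup G := Subgroup.closure (s '' Set.Iio m)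

theorem mem_initialSubgroup (s : ℕ → G) {i m : ℕ} (hi : i < m) : s i ∈ initialSubgroup s m :=
  Subgroup.subset_closure ⟨i, hi, rfl⟩

theorem initialSubgroup_mono (s : ℕ → G) {k m : ℕ} (h : k ≤ m) :
    initialSubgroup s k ≤ initialSubgroup s m :=
  Subgroup.closure_mono (Set.image_mono fun _ hi => lt_of_lt_of_le hi h)

theorem IsBraidSequence.commute_initialSubgroup {s : ℕ → G} {m : ℕ}
    (h : IsBraidSequence s (m + 2)) {g : G} (hg : g ∈ initialSubgroup s m) :
    Commute (s (m + 1)) g := by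
  induction hg using Subgroup.closure_induction with
  | mem g hg =>
    obtain ⟨i, hi, rfl⟩ := hg
    exact (h.commute i (m + 1) (Nat.succ_lt_succ hi) (Nat.lt_succ_self _)).symm
  | one => exact Commute.one_right _
  | mul x y _ _ hx hy => exact hx.mul_right hy
  | inv x _ hx => exact hx.inv_right

/-- The conditions under which a function on the Hecke algebra with generators `s 0, …, s m`
vanishes, see `VanishesOnSpan.eq_zero`. -/
structure VanishesOnSpan (z : R) (s : ℕ → G) (m : ℕ) (F : G → M) : Prop where
  hecke : IsHeckeFunction z s (m + 1) F
  low : ∀ x ∈ initialSubgroup s m, F x = 0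
  high : ∀ x ∈ initialSubgroup s m, ∀ y ∈ initialSubgroup s m, F (x * s m * y) = 0

/-- The value at `g` is the value at `1` of a right translate, so it is enough that the vanishing
conditions survive translation by each generator. Only translation by `s m` creates something new,
namely products with two letters `s m`; that is the hypothesis `double`. Inverse generators reduce
to generators by the quadratic relation. -/
theorem VanishesOnSpan.translate_of_double {z : R} {s : ℕ → G} {m : ℕ}
    (double : ∀ F : G → M, VanishesOnSpan z s m F → ∀ x ∈ initialSubgroup s m,
      ∀ y ∈ initialSubgroup s m, ∀ u ∈ initialSubgroup s m, F (x * s m * y * s m * u) = 0)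
    {g : G} (hg : g ∈ initialSubgroup s (m + 1)) (F : G → M) (hF : VanishesOnSpan z s m F) :
    VanishesOnSpan z s m fun h => F (h * g) := by
  have gen : ∀ i < m + 1, ∀ F : G → M, VanishesOnSpan z s m F →
      VanishesOnSpan z s m fun h => F (h * s i) := by
    intro i hi F hF
    refine ⟨by simpa using hF.hecke.translate 1 (s i), fun x hx => ?_, fun x hx y hy => ?_⟩
    · rcases Nat.lt_succ_iff_lt_or_eq.1 hi with hi | rfl
      · exact hF.low _ (mul_mem hx (mem_initialSubgroup s hi))
      · simpa using hF.high x hx 1 (one_mem _)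
    · rcases Nat.lt_succ_iff_lt_or_eq.1 hi with hi | rfl
      · simpa [mul_assoc] using hF.high x hx _ (mul_mem hy (mem_initialSubgroup s hi))
      · simpa using double F hF x hx y hy 1 (one_mem _)
  induction hg using Subgroup.closure_induction_right generalizing F with
  | one => simpa using hF
  | mul_right x y _ hy ih =>
    obtain ⟨i, hi, rfl⟩ := hy
    simpa [mul_assoc] using ih _ (gen i hi F hF)
  | mul_inv_cancel x y _ hy ih =>
    obtain ⟨i, hi, rfl⟩ := hy
    have h1 := gen i hi F hF
    have e : ∀ h, F (h * (s i)⁻¹) = F (h * s i) - z • F h := by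
      intro h
      have := hF.hecke i hi h 1
      simp only [mul_one] at this
      rw [← this]; abel
    have h2 : VanishesOnSpan z s m fun h => F (h * (s i)⁻¹) := by
      refine ⟨by simpa using hF.hecke.translate 1 (s i)⁻¹, fun x hx => ?_, fun x hx y hy => ?_⟩
      · simp only [e]
        rw [h1.low x hx, hF.low x hx]; simp
      · simp only [e]
        rw [h1.high x hx y hy, hF.high x hx y hy]; simp
    simpa [mul_assoc] using ih _ h2

/-- The Hecke algebra with generators `s 0, …, s m` is spanned by the elements without `s m` and
the elements that contain `s m` once. -/
theorem VanishesOnSpan.eq_zero {z : R} {s : ℕ → G} {m : ℕ} (hs : IsBraidSequence s (m + 1))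
    {F : G → M} (hF : VanishesOnSpan z s m F) {g : G} (hg : g ∈ initialSubgroup s (m + 1)) :
    F g = 0 := by
  induction m generalizing F g with
  | zero =>
    have := (translate_of_double (fun F hF x hx y hy u hu => ?_) hg F hF).low 1 (one_mem _)
    · simpa using this
    · have hy1 : y = 1 := by simpa [initialSubgroup] using hy
      have := hF.hecke.map_sq (Nat.lt_succ_self 0) x u
      rw [hF.low _ (mul_mem hx hu), hF.high x hx u hu] at this
      simpa [hy1, mul_assoc] using this
  | succ m ih =>
    have := (translate_of_double (fun F hF x hx y hy u hu => ?_) hg F hF).low 1 (one_mem _)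
    · simpa using this
    · have hsub := initialSubgroup_mono s (Nat.le_succ m)
      have hsm := mem_initialSubgroup s (Nat.lt_succ_self m)
      -- The double product is a function of its middle factor `y`, and the induction hypothesis
      -- applies to it. If `y` avoids `s m`, the two letters `s (m + 1)` meet and their square is
      -- resolved; if `y` contains `s m` once, the braid relation leaves a single `s (m + 1)`.
      have key : VanishesOnSpan z s m fun y => F (x * s (m + 1) * y * (s (m + 1) * u)) := by
        refine ⟨(hF.hecke.translate _ _).mono (Nat.le_succ _), fun a ha => ?_,
          fun a ha b hb => ?_⟩
        · have e : x * s (m + 1) * a * (s (m + 1) * u) =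
              (x * a) * (s (m + 1) * s (m + 1)) * u := by
            rw [mul_assoc x, (hs.commute_initialSubgroup ha).eq]; group
          have hxa := mul_mem hx (hsub ha)
          simp only [e]
          rw [hF.hecke.map_sq (Nat.lt_succ_self _), hF.low _ (mul_mem hxa hu),
            hF.high _ hxa u hu]
          simp
        · have e : x * s (m + 1) * (a * s m * b) * (s (m + 1) * u) =
              (x * a * s m) * s (m + 1) * (s m * b * u) := by
            calc _ = x * (s (m + 1) * a) * s m * (b * s (m + 1)) * u := by group
              _ = x * a * (s (m + 1) * s m * s (m + 1)) * b * u := by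
                rw [(hs.commute_initialSubgroup ha).eq, ← (hs.commute_initialSubgroup hb).eq]
                group
              _ = _ := by rw [← hs.braid m (Nat.lt_succ_self _)]; group
          simp only [e]
          exact hF.high _ (mul_mem (mul_mem hx (hsub ha)) hsm) _
            (mul_mem (mul_mem hsm (hsub hb)) hu)
      have := ih (hs.mono (Nat.le_succ _)) key hy
      simpa [mul_assoc] using this

end FramedHomfly

/-! ## State sums -/

namespace FramedHomfly

open Stream'

variable {K : Type*} [Field K] {N : ℕ}

/-- Operators on functions of the colours of infinitely many strands, listed from top to bottom. -/
abbrev StateOp (K : Type*) [Field K] (N : ℕ) : Type _ :=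
  Module.End K (Stream' (Fin N) → K)

/-- The operator `T` with one strand added above it. -/
def addStrand : StateOp K N →ₐ[K] StateOp K N :=
  AlgHom.ofLinearMap
    { toFun := fun T =>
        { toFun := fun φ s => T (fun t => φ (cons s.head t)) s.tail
          map_add' := fun φ ψ => funext fun s =>
            congrFun (T.map_add (fun t => φ (cons s.head t)) fun t => ψ (cons s.head t)) s.tail
          map_smul' := fun r φ => funext fun s =>
            congrFun (T.map_smul r fun t => φ (cons s.head t)) s.tail }
      map_add' := fun _ _ => rfl
      map_smul' := fun _ _ => rfl }
    (LinearMap.ext fun φ => funext fun s => congrArg φ s.eta) (fun _ _ => rfl)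

@[simp] theorem addStrand_cons (T : StateOp K N) (φ : Stream' (Fin N) → K) (a : Fin N)
    (s : Stream' (Fin N)) : addStrand T φ (cons a s) = T (fun t => φ (cons a t)) s := rfl

/-- The operator of the arc `⊂` with weights `w`. -/
def cupOp (w : Fin N → K) : StateOp K N where
  toFun φ s := ∑ i, w i * φ (cons i (cons i s))
  map_add' φ ψ := by ext s; simp [mul_add, Finset.sum_add_distrib]
  map_smul' r φ := by ext s; simp [Finset.mul_sum, mul_left_comm]

@[simp] theorem cupOp_apply (w : Fin N → K) (φ : Stream' (Fin N) → K) (s : Stream' (Fin N)) :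
    cupOp w φ s = ∑ i, w i * φ (cons i (cons i s)) := rfl

/-- The operator of the arc `⊃` with weights `w`. -/
def capOp (w : Fin N → K) : StateOp K N where
  toFun φ s := if s.head = s.tail.head then w s.head * φ s.tail.tail else 0
  map_add' φ ψ := by ext s; simp only [Pi.add_apply]; split_ifs <;> simp [mul_add]
  map_smul' r φ := by
    ext s; simp only [Pi.smul_apply]; split_ifs <;> simp [mul_left_comm]

@[simp] theorem capOp_cons (w : Fin N → K) (φ : Stream' (Fin N) → K) (a b : Fin N)
    (s : Stream' (Fin N)) :
    capOp w φ (cons a (cons b s)) = if a = b then w a * φ s else 0 := rfl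

/-- The weight of a crossing of sign `c` where the upper strands on both sides have the colour `a`
and the lower strands have the colour `b`. -/
def diagWeight (q : K) (c : Bool) (a b : Fin N) : K :=
  if a = b then (if c then q else q⁻¹)
  else if c then (if a < b then q - q⁻¹ else 0) else (if b < a then -(q - q⁻¹) else 0)

/-- The operator of a crossing of sign `c`. -/
def crossOp (q : K) (c : Bool) : StateOp K N where
  toFun φ s := diagWeight q c s.head s.tail.head * φ (cons s.head (cons s.tail.head s.tail.tail)) +
    if s.head = s.tail.head then 0 else φ (cons s.tail.head (cons s.head s.tail.tail))
  map_add' φ ψ := by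
    ext s; simp only [Pi.add_apply]; split_ifs <;> ring
  map_smul' r φ := by
    ext s; simp only [Pi.smul_apply, smul_eq_mul, RingHom.id_apply]; split_ifs <;> ring

@[simp] theorem crossOp_cons (q : K) (c : Bool) (φ : Stream' (Fin N) → K) (a b : Fin N)
    (s : Stream' (Fin N)) :
    crossOp q c φ (cons a (cons b s)) = diagWeight q c a b * φ (cons a (cons b s)) +
      if a = b then 0 else φ (cons b (cons a s)) := rfl

/-- The weight of an arc that turns clockwise from left to right. -/
def arcWeight (q : K) (i : Fin N) : K := q ^ (2 * (i : ℤ) - N + 1)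

/-- The operator of an elementary piece. -/
def pieceOp (q : K) : Piece → StateOp K N
  | .cup b => cupOp (if b then 1 else fun i => (arcWeight q i)⁻¹)
  | .cap b => capOp (if b then arcWeight q else 1)
  | .cross c => crossOp q c

/-- The operator of a slice. -/
def sliceOp (q : K) (x : Slice) : StateOp K N :=
  (addStrand ^ x.above.length) (pieceOp q x.piece)

/-- The operator of a tangle diagram. -/
def tangleOp (q : K) (w : List Slice) : StateOp K N := (w.map (sliceOp q)).prod

theorem tangleOp_append (q : K) (a b : List Slice) :
    tangleOp (N := N) q (a ++ b) = tangleOp q a * tangleOp q b := by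
  simp [tangleOp]

/-- The strands `B` leave no trace: operators act on infinite sequences of colours, so there are
always idle strands below. -/
theorem tangleOp_whisker (q : K) (A w B) :
    tangleOp (N := N) q (whisker A w B) = (addStrand ^ A.length) (tangleOp q w) := by
  induction w with
  | nil => simp [tangleOp, whisker]
  | cons x w ih =>
    have e : whisker A (x :: w) B = ⟨A ++ x.above, x.piece, x.below ++ B⟩ :: whisker A w B := rfl
    have e2 : ∀ (y : Slice) (w : List Slice),
        tangleOp (N := N) q (y :: w) = sliceOp q y * tangleOp q w := fun y w => by simp [tangleOp]
    rw [e, e2, e2, map_mul, ih]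
    simp [sliceOp, pow_add, AlgHom.mul_apply]

/-- Three exposed colours suffice for all the computations with local pieces; the third Reidemeister
move needs all three. -/
theorem stateOp_ext {S T : StateOp K N} (h : ∀ φ a b c s, S φ (cons a (cons b (cons c s))) =
    T φ (cons a (cons b (cons c s)))) : S = T := by
  refine LinearMap.ext fun φ => funext fun s => ?_
  have := h φ s.head s.tail.head s.tail.tail.head s.tail.tail.tail
  simpa only [Stream'.eta] using this

/-- The piece touches only the top strands and `T` only those below it. A piece acts by a finite
linear combination of substitutions of colours, and the linearity of `T` carries it through. -/
theorem pieceOp_exchange (q : K) (g : Piece) (T : StateOp K N) :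
    pieceOp q g * (addStrand ^ g.cod.length) T = (addStrand ^ g.dom.length) T * pieceOp q g := by
  refine stateOp_ext fun φ a b c s => ?_
  cases g with
  | cup x =>
    set w : Fin N → K := if x then 1 else fun i => (arcWeight q i)⁻¹ with hw
    have : (cupOp w φ) = ∑ i, w i • fun s => φ (cons i (cons i s)) := by
      ext s; simp
    simp [pieceOp, Piece.cod, Piece.dom, pow_succ, AlgHom.mul_apply, ← hw, this, map_sum]
  | cap x =>
    set w : Fin N → K := if x then arcWeight q else 1 with hw
    simp only [pieceOp, Piece.cod, Piece.dom, pow_succ, AlgHom.mul_apply, ← hw, pow_zero,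
      AlgHom.one_apply, List.length_cons, List.length_nil, Module.End.mul_apply, capOp_cons,
      addStrand_cons]
    split_ifs
    · exact (congrFun (T.map_smul (w a) φ) _).symm
    · exact (congrFun T.map_zero _).symm
  | cross x =>
    simp only [pieceOp, Piece.cod, Piece.dom, pow_succ, AlgHom.mul_apply, pow_zero,
      AlgHom.one_apply, List.length_cons, List.length_nil, Module.End.mul_apply, crossOp_cons,
      addStrand_cons]
    have h := T.map_add (diagWeight q x a b • fun t => φ (cons a (cons b t)))
      (if a = b then 0 else fun t => φ (cons b (cons a t)))
    have := congrFun h (cons c s)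
    rw [T.map_smul] at this
    simp only [Pi.add_apply, Pi.smul_apply, smul_eq_mul] at this
    convert this.symm using 2
    · split_ifs <;> simp
    · ext t
      split_ifs <;> simp

/-! ### Telescoping sums of crossing and arc weights. -/

theorem sum_sub_of_lt (g : ℕ → K) {a f : ℕ} (h : a < f) (hf : f ≤ N) :
    (∑ e : Fin N, if a < e ∧ (e : ℕ) < f then g (e + 1) - g e else 0) = g f - g (a + 1) := by
  rw [Fin.sum_univ_eq_sum_range (fun e => if a < e ∧ e < f then g (e + 1) - g e else 0) N,
    ← Finset.sum_filter]
  have : (Finset.range N).filter (fun e => a < e ∧ e < f) = Finset.Ico (a + 1) f := by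
    ext e; simp; omega
  rw [this, Finset.sum_Ico_eq_sub _ h, Finset.sum_range_sub, Finset.sum_range_sub]
  ring

theorem sum_sub_of_lt' (g : ℕ → K) {a : ℕ} (ha : a ≤ N) :
    (∑ e : Fin N, if (e : ℕ) < a then g (e + 1) - g e else 0) = g a - g 0 := by
  rw [Fin.sum_univ_eq_sum_range (fun e => if e < a then g (e + 1) - g e else 0) N,
    ← Finset.sum_filter]
  have : (Finset.range N).filter (fun e => e < a) = Finset.range a := by
    ext e; simp; omega
  rw [this, Finset.sum_range_sub]

section Sums

variable {q : K} (hq : q ≠ 0)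

include hq

theorem arcWeight_ne_zero (i : Fin N) : arcWeight q i ≠ 0 := zpow_ne_zero _ hq

/-- The arc weights are consecutive powers of q², so that after multiplication by `q - q⁻¹` they
telescope. All the sums over a colour below rest on this. -/
theorem mul_arcWeight (e : Fin N) : (q - q⁻¹) * arcWeight q e =
    q ^ (2 * ((e + 1 : ℕ) : ℤ) - N) - q ^ (2 * ((e : ℕ) : ℤ) - N) := by
  rw [arcWeight, sub_mul, ← zpow_one_add₀ hq, ← zpow_neg_one, ← zpow_add₀ hq]
  push_cast
  congr 2 <;> ring

theorem mul_arcWeight_inv (e : Fin N) : (q - q⁻¹) * (arcWeight q e)⁻¹ =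
    -q ^ ((N : ℤ) - 2 * ((e + 1 : ℕ) : ℤ)) - -q ^ ((N : ℤ) - 2 * ((e : ℕ) : ℤ)) := by
  rw [arcWeight, ← zpow_neg, sub_mul, ← zpow_one_add₀ hq, ← zpow_neg_one, ← zpow_add₀ hq]
  push_cast
  rw [neg_sub_neg]
  congr 2 <;> ring

theorem q_mul_arcWeight (i : Fin N) : q * arcWeight q i = q ^ (2 * ((i + 1 : ℕ) : ℤ) - N) := by
  rw [arcWeight, ← zpow_one_add₀ hq]; push_cast; congr 1; ring

theorem q_inv_mul_arcWeight (i : Fin N) : q⁻¹ * arcWeight q i = q ^ (2 * ((i : ℕ) : ℤ) - N) := by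
  rw [arcWeight, ← zpow_neg_one, ← zpow_add₀ hq]; congr 1; ring

theorem q_mul_arcWeight_inv (i : Fin N) :
    q * (arcWeight q i)⁻¹ = q ^ ((N : ℤ) - 2 * ((i : ℕ) : ℤ)) := by
  rw [arcWeight, ← zpow_neg, ← zpow_one_add₀ hq]; congr 1; ring

theorem q_inv_mul_arcWeight_inv (i : Fin N) :
    q⁻¹ * (arcWeight q i)⁻¹ = q ^ ((N : ℤ) - 2 * ((i + 1 : ℕ) : ℤ)) := by
  rw [arcWeight, ← zpow_neg, ← zpow_neg_one, ← zpow_add₀ hq]; push_cast; congr 1; ring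

/-- Orthogonality behind the second Reidemeister move with opposite orientations. Only colours
between `a` and `f` contribute; for `a < f` the two end terms cancel the telescoping sum over the
colours strictly between, and for `f < a` there are no terms. -/
theorem sum_diagWeight_true (a f : Fin N) :
    ∑ e, diagWeight q true a e * diagWeight q false f e * arcWeight q e =
      if a = f then arcWeight q a else 0 := by
  rcases lt_trichotomy a f with h | rfl | h
  · have key : ∀ e, diagWeight q true a e * diagWeight q false f e * arcWeight q e =
        (if e = a then -(q - q⁻¹) * (q * arcWeight q a) else 0) +
        (if e = f then (q - q⁻¹) * (q⁻¹ * arcWeight q f) else 0) +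
        -(q - q⁻¹) * (if (a : ℕ) < e ∧ (e : ℕ) < f then (q - q⁻¹) * arcWeight q e else 0) := by
      intro e
      rcases lt_trichotomy e a with h1 | rfl | h1
      · have h2 := h1.trans h
        simp [diagWeight, h1.ne, h1.ne', h1.not_gt, h2.ne]
      · simp [diagWeight, h, h.ne, h.ne']
        ring
      · rcases lt_trichotomy e f with h2 | rfl | h2
        · simp [diagWeight, h1, h1.ne, h1.ne', h2, h2.ne, h2.ne']
          ring
        · simp [diagWeight, h1, h1.ne, h1.ne']
          ring
        · simp [diagWeight, h1.ne', h2.not_gt, h2.ne']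
          intro h3
          exact absurd h3 h2.ne
    rw [Finset.sum_congr rfl fun e _ => key e, Finset.sum_add_distrib, Finset.sum_add_distrib,
      ← Finset.mul_sum, Finset.sum_ite_eq' , Finset.sum_ite_eq']
    simp only [mul_arcWeight hq, q_mul_arcWeight hq, q_inv_mul_arcWeight hq]
    rw [sum_sub_of_lt (fun e : ℕ => q ^ (2 * (e : ℤ) - N)) h f.isLt.le]
    simp [h.ne]
    ring
  · have key : ∀ e, diagWeight q true a e * diagWeight q false a e * arcWeight q e =
        if e = a then arcWeight q a else 0 := by
      intro e
      rcases lt_trichotomy e a with h1 | rfl | h1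
      · simp [diagWeight, h1.ne, h1.ne', h1.not_gt]
      · simp [diagWeight, hq]
      · simp [diagWeight, h1.ne, h1.ne', h1.not_gt]
    simp [key]
  · have key : ∀ e, diagWeight q true a e * diagWeight q false f e * arcWeight q e = 0 := by
      intro e
      rcases lt_trichotomy e a with h1 | rfl | h1
      · simp [diagWeight, h1.ne', h1.not_gt]
      · simp [diagWeight, h.ne, h.not_gt]
      · have h2 := h.trans h1
        simp [diagWeight, h2.ne, h2.not_gt]
    simp [key, h.ne']

theorem sum_diagWeight (c : Bool) (a f : Fin N) :
    ∑ e, diagWeight q c a e * diagWeight q (!c) f e * arcWeight q e =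
      if a = f then arcWeight q a else 0 := by
  cases c
  · rw [show (!false) = true from rfl,
      Finset.sum_congr rfl fun e _ => by rw [mul_comm (diagWeight q false a e)],
      sum_diagWeight_true hq]
    by_cases h : a = f
    · simp [h]
    · simp [h, Ne.symm h]
  · exact sum_diagWeight_true hq a f

theorem sum_diagWeight_true' (a f : Fin N) :
    ∑ e, diagWeight q true e a * diagWeight q false e f * (arcWeight q e)⁻¹ =
      if a = f then (arcWeight q a)⁻¹ else 0 := by
  rcases lt_trichotomy f a with h | rfl | h
  · have key : ∀ e, diagWeight q true e a * diagWeight q false e f * (arcWeight q e)⁻¹ =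
        (if e = a then -(q - q⁻¹) * (q * (arcWeight q a)⁻¹) else 0) +
        (if e = f then (q - q⁻¹) * (q⁻¹ * (arcWeight q f)⁻¹) else 0) +
        -(q - q⁻¹) * (if (f : ℕ) < e ∧ (e : ℕ) < a then (q - q⁻¹) * (arcWeight q e)⁻¹ else 0) := by
      intro e
      rcases lt_trichotomy e f with h1 | rfl | h1
      · have h2 := h1.trans h
        simp [diagWeight, h1.ne, h2.ne, h1.not_gt]
      · simp [diagWeight, h, h.ne]
        ring
      · rcases lt_trichotomy e a with h2 | rfl | h2
        · simp [diagWeight, h1, h1.ne', h2, h2.ne]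
          ring
        · simp [diagWeight, h1, h1.ne']
          ring
        · simp [diagWeight, h1.ne', h2.not_gt, h2.ne']
    rw [Finset.sum_congr rfl fun e _ => key e, Finset.sum_add_distrib, Finset.sum_add_distrib,
      ← Finset.mul_sum, Finset.sum_ite_eq' , Finset.sum_ite_eq']
    simp only [mul_arcWeight_inv hq, q_mul_arcWeight_inv hq, q_inv_mul_arcWeight_inv hq]
    rw [sum_sub_of_lt (fun e : ℕ => -q ^ ((N : ℤ) - 2 * (e : ℤ))) h a.isLt.le]
    simp [h.ne']
    ring
  · have key : ∀ e, diagWeight q true e f * diagWeight q false e f * (arcWeight q e)⁻¹ =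
        if e = f then (arcWeight q f)⁻¹ else 0 := by
      intro e
      rcases lt_trichotomy e f with h1 | rfl | h1
      · simp [diagWeight, h1.ne, h1.not_gt]
      · simp [diagWeight, hq]
      · simp [diagWeight, h1.ne', h1.not_gt]
    simp [key]
  · have key : ∀ e, diagWeight q true e a * diagWeight q false e f * (arcWeight q e)⁻¹ = 0 := by
      intro e
      rcases lt_trichotomy e a with h1 | rfl | h1
      · have h2 := h1.trans h
        simp [diagWeight, h2.ne, h2.not_gt]
      · simp [diagWeight, h.ne, h.not_gt]
      · simp [diagWeight, h1.ne', h1.not_gt]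
    simp [key, h.ne]

theorem sum_diagWeight' (c : Bool) (a f : Fin N) :
    ∑ e, diagWeight q c e a * diagWeight q (!c) e f * (arcWeight q e)⁻¹ =
      if a = f then (arcWeight q a)⁻¹ else 0 := by
  cases c
  · rw [show (!false) = true from rfl,
      Finset.sum_congr rfl fun e _ => by rw [mul_comm (diagWeight q false e a)],
      sum_diagWeight_true' hq]
    by_cases h : a = f
    · simp [h]
    · simp [h, Ne.symm h]
  · exact sum_diagWeight_true' hq a f

/-- The factor by which a kink with a crossing of sign `c` multiplies the state sum. -/
theorem sum_diagWeight_mul_arcWeight (a : Fin N) :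
    ∑ e, diagWeight q true a e * arcWeight q e = q ^ (N : ℤ) := by
  have key : ∀ e, diagWeight q true a e * arcWeight q e =
      (if e = a then q * arcWeight q a else 0) +
      (if (a : ℕ) < e ∧ (e : ℕ) < N then (q - q⁻¹) * arcWeight q e else 0) := by
    intro e
    rcases lt_trichotomy e a with h | rfl | h
    · simp [diagWeight, h.ne', h.not_gt, h.ne]
    · simp [diagWeight]
    · simp [diagWeight, h, h.ne', h.ne]
  rw [Finset.sum_congr rfl fun e _ => key e, Finset.sum_add_distrib, Finset.sum_ite_eq']
  simp only [mul_arcWeight hq, q_mul_arcWeight hq]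
  rw [sum_sub_of_lt (fun e : ℕ => q ^ (2 * (e : ℤ) - N)) a.isLt le_rfl]
  simp only [Finset.mem_univ, if_true, add_sub_cancel]
  congr 1; ring

theorem sum_diagWeight_mul_arcWeight_inv (a : Fin N) :
    ∑ e, diagWeight q true e a * (arcWeight q e)⁻¹ = q ^ (N : ℤ) := by
  have key : ∀ e, diagWeight q true e a * (arcWeight q e)⁻¹ =
      (if e = a then q * (arcWeight q a)⁻¹ else 0) +
      (if (e : ℕ) < a then (q - q⁻¹) * (arcWeight q e)⁻¹ else 0) := by
    intro e
    rcases lt_trichotomy e a with h | rfl | h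
    · simp [diagWeight, h, h.ne]
    · simp [diagWeight]
    · simp [diagWeight, h.ne', h.not_gt]
  rw [Finset.sum_congr rfl fun e _ => key e, Finset.sum_add_distrib, Finset.sum_ite_eq']
  simp only [mul_arcWeight_inv hq, q_mul_arcWeight_inv hq]
  rw [sum_sub_of_lt' (fun e : ℕ => -q ^ ((N : ℤ) - 2 * (e : ℤ))) a.isLt.le]
  simp

end Sums

theorem tangleOp_cons (q : K) (A : List Bool) (p : Piece) (B : List Bool) (w : List Slice) :
    tangleOp (N := N) q (⟨A, p, B⟩ :: w) = (addStrand ^ A.length) (pieceOp q p) * tangleOp q w := by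
  simp [tangleOp, sliceOp]

theorem tangleOp_nil (q : K) : tangleOp (N := N) q [] = 1 := rfl

/-- The skein relation at the level of operators; it also transfers the kink computations from
positive to negative crossings. -/
theorem crossOp_false (q : K) : crossOp (N := N) q false = crossOp q true - (q - q⁻¹) • 1 := by
  refine stateOp_ext fun φ a b c s => ?_
  rcases lt_trichotomy a b with h | rfl | h
  · simp [diagWeight, h, h.ne, h.not_gt]
  · simp [diagWeight]; ring
  · simp [diagWeight, h, h.ne', h.not_gt]; ring

theorem ite_ite_zero {P : Prop} [Decidable P] (r : K) :
    (if P then (0 : K) else if P then r else 0) = 0 := by split_ifs <;> rfl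

/-! ### Invariance of the state sum under the Reidemeister moves; positive kinks. -/

section Moves

variable {q : K} (hq : q ≠ 0)

include hq

theorem crossOp_mul_not (c : Bool) : crossOp (N := N) q c * crossOp q (!c) = 1 := by
  refine stateOp_ext fun φ a b e s => ?_
  rcases lt_trichotomy a b with h | rfl | h
  · cases c <;> simp [diagWeight, h, h.ne, h.ne', h.not_gt]; try ring
  · cases c <;> simp [diagWeight, hq]
  · cases c <;> simp [diagWeight, h, h.ne, h.ne', h.not_gt]; try ring

theorem crossOp_braid_true : crossOp (N := N) q true * addStrand (crossOp q true) * crossOp q true =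
    addStrand (crossOp q true) * crossOp q true * addStrand (crossOp q true) := by
  refine stateOp_ext fun φ a b c s => ?_
  rcases lt_trichotomy a b with h1 | h1 | h1 <;> rcases lt_trichotomy b c with h2 | h2 | h2 <;>
    rcases lt_trichotomy a c with h3 | h3 | h3 <;>
    first
      | (exfalso; order)
      | (subst_vars
         simp [diagWeight, *, ne_of_lt, ne_of_gt, not_lt_of_gt]
         try field_simp
         try ring)

theorem crossOp_braid (c : Bool) : crossOp (N := N) q c * addStrand (crossOp q c) * crossOp q c =
    addStrand (crossOp q c) * crossOp q c * addStrand (crossOp q c) := by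
  cases c
  -- The negative crossing is the inverse of the positive one, so inverting the positive braid
  -- relation gives the negative one.
  · let X : (StateOp K N)ˣ :=
      ⟨crossOp q true, crossOp q false, crossOp_mul_not hq true, crossOp_mul_not hq false⟩
    let Y : (StateOp K N)ˣ := Units.map (addStrand : StateOp K N →ₐ[K] StateOp K N) X
    have h : X * Y * X = Y * X * Y := Units.ext (crossOp_braid_true hq)
    have h2 : X⁻¹ * Y⁻¹ * X⁻¹ = Y⁻¹ * X⁻¹ * Y⁻¹ := by
      have := congrArg (·⁻¹) h
      simpa [mul_assoc] using this
    exact congrArg Units.val h2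
  · exact crossOp_braid_true hq

theorem tangleOp_zigzag_left (b : Bool) :
    tangleOp (N := N) q [⟨[b], .cup (!b), []⟩, ⟨[], .cap b, [b]⟩] = 1 := by
  have hw := arcWeight_ne_zero (N := N) hq
  refine stateOp_ext fun φ a b' e s => ?_
  cases b <;> simp [tangleOp_cons, tangleOp_nil, pieceOp, hw]

theorem tangleOp_zigzag_right (b : Bool) :
    tangleOp (N := N) q [⟨[], .cup b, [b]⟩, ⟨[b], .cap (!b), []⟩] = 1 := by
  have hw := arcWeight_ne_zero (N := N) hq
  refine stateOp_ext fun φ a b' e s => ?_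
  cases b <;> simp [tangleOp_cons, tangleOp_nil, pieceOp, hw]

theorem tangleOp_full_turn (c : Bool) :
    tangleOp (N := N) q (halfTurnClockwise c) = tangleOp q (halfTurnCounterclockwise c) := by
  have hw := arcWeight_ne_zero (N := N) hq
  refine stateOp_ext fun φ a b e s => ?_
  simp [tangleOp_cons, tangleOp_nil, pieceOp, halfTurnClockwise, halfTurnCounterclockwise, pow_succ,
    AlgHom.mul_apply]
  rw [Finset.sum_comm (f := fun x x_1 => (if b = x then _ else _) + _)]
  refine Finset.sum_congr rfl fun x _ => ?_
  rw [Finset.mul_sum]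
  refine Finset.sum_congr rfl fun y _ => ?_
  have hx := hw x
  have hy := hw y
  simp only [eq_comm (a := b), eq_comm (a := a)]
  by_cases h1 : x = a <;> by_cases h2 : y = b <;> by_cases h3 : y = a <;> by_cases h4 : x = b <;>
    simp_all [mul_left_comm]

theorem tangleOp_two_opp (c : Bool) :
    tangleOp (N := N) q (quarterTurnUp c ++ quarterTurnDown (!c)) = 1 := by
  have hw := arcWeight_ne_zero (N := N) hq
  refine stateOp_ext fun φ a b e s => ?_
  simp [tangleOp_cons, tangleOp_nil, pieceOp, quarterTurnUp, quarterTurnDown, pow_succ,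
    AlgHom.mul_apply]
  simp only [ite_ite_zero]
  by_cases hab : a = b
  · subst hab
    simp only [ite_ite_zero, if_true, add_zero, Finset.mul_sum]
    rw [Finset.sum_comm]
    have key : ∀ y : Fin N, ∑ x, diagWeight q c a x * ((arcWeight q y)⁻¹ *
        (diagWeight q (!c) y x * (arcWeight q x * φ (cons y (cons y (cons e s)))))) =
        if a = y then φ (cons y (cons y (cons e s))) else 0 := by
      intro y
      rw [Finset.sum_congr rfl fun x _ => show _ = (arcWeight q y)⁻¹ *
        φ (cons y (cons y (cons e s))) *
          (diagWeight q c a x * diagWeight q (!c) y x * arcWeight q x) by ring,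
        ← Finset.mul_sum, sum_diagWeight hq]
      by_cases h : a = y
      · subst h; simp; field_simp [hw a]
      · simp [h]
    simp [key]
  -- For different colours at the left end the diagonal weights of the first crossing cannot be
  -- closed by its cap. Each colour must pass straight through, which fixes both summation colours.
  · refine (Finset.sum_eq_single a (fun x _ hx => by simp [Ne.symm hx, hab]) (by simp)).trans ?_
    rw [if_neg hab, zero_add, if_neg (Ne.symm hab), if_pos rfl]
    refine (Finset.sum_eq_single a (fun x _ hx => by simp [hx, Ne.symm hab]) (by simp)).trans ?_
    simp [hab, Ne.symm hab, hw a]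

theorem tangleOp_two_opp' (c : Bool) :
    tangleOp (N := N) q (quarterTurnDown c ++ quarterTurnUp (!c)) = 1 := by
  have hw := arcWeight_ne_zero (N := N) hq
  refine stateOp_ext fun φ a b e s => ?_
  simp [tangleOp_cons, tangleOp_nil, pieceOp, quarterTurnUp, quarterTurnDown, pow_succ,
    AlgHom.mul_apply]
  simp only [ite_ite_zero]
  by_cases hab : a = b
  · subst hab
    simp only [ite_ite_zero, if_true, add_zero, Finset.mul_sum]
    rw [Finset.sum_comm]
    have key : ∀ y : Fin N, ∑ x, (arcWeight q x)⁻¹ * (diagWeight q c x a * (arcWeight q a *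
        (diagWeight q (!c) x y * φ (cons y (cons y (cons e s)))))) =
        if a = y then φ (cons y (cons y (cons e s))) else 0 := by
      intro y
      rw [Finset.sum_congr rfl fun x _ => show _ = arcWeight q a *
        φ (cons y (cons y (cons e s))) *
          (diagWeight q c x a * diagWeight q (!c) x y * (arcWeight q x)⁻¹) by ring,
        ← Finset.mul_sum, sum_diagWeight' hq]
      by_cases h : a = y
      · subst h; simp; field_simp [hw a]
      · simp [h]
    simp [key]
  · refine (Finset.sum_eq_single b (fun x _ hx => by simp [hx, hab]) (by simp)).trans ?_
    rw [if_neg hab, zero_add, if_neg (Ne.symm hab), if_pos rfl]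
    refine (congrArg _ (congrArg _ (Finset.sum_eq_single b
      (fun x _ hx => by simp [Ne.symm hx, Ne.symm hab]) (by simp)))).trans ?_
    simp [hab, Ne.symm hab, hw b]

theorem tangleOp_kinkBelow :
    tangleOp (N := N) q (kinkBelow true) = (q ^ (N : ℤ)) • 1 := by
  refine stateOp_ext fun φ a b e s => ?_
  simp [tangleOp_cons, tangleOp_nil, pieceOp, kinkBelow, pow_succ]
  simp only [ite_ite_zero, add_zero, ← mul_assoc]
  rw [← Finset.sum_mul, sum_diagWeight_mul_arcWeight hq, zpow_natCast]

theorem tangleOp_kinkAbove :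
    tangleOp (N := N) q (kinkAbove true) = (q ^ (N : ℤ)) • 1 := by
  refine stateOp_ext fun φ a b e s => ?_
  simp [tangleOp_cons, tangleOp_nil, pieceOp, kinkAbove, pow_succ]
  simp only [ite_ite_zero, add_zero, ← mul_assoc]
  rw [← Finset.sum_mul, Finset.sum_congr rfl fun x _ => mul_comm (arcWeight q x)⁻¹ _,
    sum_diagWeight_mul_arcWeight_inv hq, zpow_natCast]

end Moves

/-! ### Laurent polynomials vanishing at infinitely many points. -/

theorem coeff_T_mul {R : Type*} [Semiring R] (k : ℤ) (p : LaurentPolynomial R) (n : ℤ) :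
    (LaurentPolynomial.T k * p).coeff n = p.coeff (n - k) := by
  rw [LaurentPolynomial.T, AddMonoidAlgebra.coeff_single_mul_eq_mul_coeff (n - k)
    (fun a _ => by omega), one_mul]

/-- A power of the indeterminate clears the negative exponents; what remains is a polynomial over a
field with infinitely many roots. -/
theorem map_coeff_eq_zero_of_eval₂ {R K : Type*} [CommRing R] [Field K] (f : R →+* K)
    (p : LaurentPolynomial R) {S : Set Kˣ} (hS : S.Infinite)
    (h : ∀ x ∈ S, LaurentPolynomial.eval₂ f x p = 0) (n : ℤ) : f (p.coeff n) = 0 := by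
  obtain ⟨k, p', hp⟩ := LaurentPolynomial.exists_T_pow p
  have hp' : p'.map f = 0 := by
    refine Polynomial.eq_zero_of_infinite_isRoot _ ((hS.image Units.val_injective.injOn).mono ?_)
    rintro _ ⟨x, hx, rfl⟩
    rw [Set.mem_ofPred_eq, Polynomial.IsRoot, Polynomial.eval_map,
      ← LaurentPolynomial.eval₂_toLaurent, hp, map_mul, h x hx, zero_mul]
  have e : p.coeff n = (Polynomial.toLaurent p').coeff (n + k) := by
    rw [hp, ← LaurentPolynomial.T_mul, coeff_T_mul]
    simp
  rw [e, LaurentPolynomial.coeff_toLaurent]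
  by_cases hn : 0 ≤ n + k
  · obtain ⟨m, hm⟩ := Int.eq_ofNat_of_zero_le hn
    rw [hm, show ((m : ℕ) : ℤ) = Nat.castEmbedding m from rfl,
      Finsupp.mapDomain_apply Nat.castEmbedding.injective]
    have : f (p'.coeff m) = 0 := by rw [← Polynomial.coeff_map, hp', Polynomial.coeff_zero]
    exact this
  · rw [Finsupp.mapDomain_of_notMem_range]
    · simp
    · rintro ⟨m, hm⟩
      rw [← hm] at hn
      exact hn (Int.natCast_nonneg m)

/-! ### Skein relation, regular moves and negative kinks for the state sum. -/

theorem tangleOp_skein (q : K) (u w : List Slice) (A B : List Bool) :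
    tangleOp (N := N) q (u ++ whisker A [⟨[], .cross true, []⟩] B ++ w) -
      tangleOp q (u ++ whisker A [⟨[], .cross false, []⟩] B ++ w) =
        (q - q⁻¹) • tangleOp q (u ++ w) := by
  simp only [tangleOp_append, tangleOp_whisker, tangleOp_cons, tangleOp_nil, List.length_nil,
    pow_zero, AlgHom.one_apply, mul_one, pieceOp, crossOp_false, map_sub, map_smul, map_one]
  rw [← sub_mul, ← mul_sub, sub_sub_cancel, mul_smul_comm, smul_mul_assoc, mul_one]

section Moves

variable {q : K} (hq : q ≠ 0)

include hq

theorem tangleOp_eq_of_regularMove {a b : List Slice} (h : RegularMove a b) :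
    tangleOp (N := N) q a = tangleOp q b := by
  cases h with
  | exchange g h m =>
    simp only [tangleOp_cons, tangleOp_nil, List.length_append, pow_add, AlgHom.mul_apply, mul_one,
      List.length_nil, pow_zero, AlgHom.one_apply]
    exact pieceOp_exchange q g _
  | zigzag_left b => exact tangleOp_zigzag_left hq b
  | zigzag_right b => exact tangleOp_zigzag_right hq b
  | full_turn c => exact tangleOp_full_turn hq c
  | reidemeister_two c =>
    simpa [tangleOp_cons, tangleOp_nil, pieceOp] using crossOp_mul_not hq c
  | reidemeister_two_opp c => exact tangleOp_two_opp hq c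
  | reidemeister_two_opp' c => exact tangleOp_two_opp' hq c
  | reidemeister_three c =>
    simpa [tangleOp_cons, tangleOp_nil, pieceOp, mul_assoc] using crossOp_braid hq c

/-- The value of the state sum on the crossingless unknot, up to a factor. -/
theorem mul_sum_arcWeight :
    (q - q⁻¹) * ∑ e : Fin N, arcWeight q e = q ^ (N : ℤ) - q ^ (-(N : ℤ)) := by
  rw [Finset.mul_sum]
  have := sum_sub_of_lt' (N := N) (fun e : ℕ => q ^ (2 * (e : ℤ) - N)) le_rfl
  simp only [Fin.is_lt, if_true] at this
  simp only [mul_arcWeight hq]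
  rw [this]
  congr 2
  · ring
  · simp

theorem mul_sum_arcWeight_inv :
    (q - q⁻¹) * ∑ e : Fin N, (arcWeight q e)⁻¹ = q ^ (N : ℤ) - q ^ (-(N : ℤ)) := by
  rw [Finset.mul_sum]
  have := sum_sub_of_lt' (N := N) (fun e : ℕ => -q ^ ((N : ℤ) - 2 * (e : ℤ))) le_rfl
  simp only [Fin.is_lt, if_true] at this
  simp only [mul_arcWeight_inv hq]
  rw [this, neg_sub_neg]
  congr 2
  ring

/-- By the skein relation a negative kink is a positive kink minus `q - q⁻¹` times a strand with a
separate circle, and `mul_sum_arcWeight` evaluates the circle: q^N - (q^N - q^{-N}) = q^{-N}. -/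
theorem tangleOp_kinkBelow_false :
    tangleOp (N := N) q (kinkBelow false) = q ^ (-(N : ℤ)) • 1 := by
  have h := tangleOp_kinkBelow (N := N) hq
  have hs : (addStrand (cupOp 1) * addStrand (capOp (arcWeight q)) : StateOp K N) =
      (∑ e : Fin N, arcWeight q e) • 1 := by
    refine stateOp_ext fun φ a b c s => ?_
    simp [Finset.sum_mul]
  simp only [kinkBelow, tangleOp_cons, tangleOp_nil, List.length_cons, List.length_nil, pow_zero,
    zero_add, pow_one, AlgHom.one_apply, mul_one, pieceOp, if_true] at h ⊢
  rw [crossOp_false, sub_mul, mul_sub, h, smul_mul_assoc, mul_smul_comm, one_mul, hs, smul_smul,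
    mul_sum_arcWeight hq, ← sub_smul (q ^ (N : ℤ)), sub_sub_cancel]

theorem tangleOp_kinkAbove_false :
    tangleOp (N := N) q (kinkAbove false) = q ^ (-(N : ℤ)) • 1 := by
  have h := tangleOp_kinkAbove (N := N) hq
  have hs : (cupOp (fun i => (arcWeight q i)⁻¹) * capOp 1 : StateOp K N) =
      (∑ e : Fin N, (arcWeight q e)⁻¹) • 1 := by
    refine stateOp_ext fun φ a b c s => ?_
    simp [Finset.sum_mul]
  simp only [kinkAbove, tangleOp_cons, tangleOp_nil, List.length_cons, List.length_nil, pow_zero,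
    zero_add, pow_one, AlgHom.one_apply, mul_one, pieceOp, Bool.false_eq_true, if_false] at h ⊢
  rw [crossOp_false, map_sub, map_smul, map_one, sub_mul, mul_sub, h, smul_mul_assoc,
    mul_smul_comm, one_mul, hs, smul_smul, mul_sum_arcWeight_inv hq, ← sub_smul (q ^ (N : ℤ)), sub_sub_cancel]

end Moves

/-- The specialization `v = x`, `z = y`. -/
noncomputable def specialize (x y : Kˣ) : Poly →+* K :=
  LaurentPolynomial.eval₂ (LaurentPolynomial.eval₂ (Int.castRingHom K) y) x

theorem specialize_v (x y : Kˣ) (k : ℤ) : specialize x y (v k) = (x ^ k : Kˣ) := by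
  simp [specialize, v]

theorem specialize_z (x y : Kˣ) : specialize x y z = y := by
  simp [specialize, z]

/-- The state sum of a diagram. -/
def stateSum (q : K) (c : Fin N) (D : LinkDiagram) : K :=
  tangleOp q D.slices (fun _ => 1) (Stream'.const c)

/-- The state sum is a model of the skein relations at v = q^{-N}, z = q - q⁻¹. It therefore induces
a functional on the skein module, which detects the class of the unknot. -/
theorem stateSum_relation {q : K} (c : Fin N) {x y : Kˣ} (hq : q ≠ 0)
    (hx : (x : K) = q ^ (-(N : ℤ))) (hy : (y : K) = q - q⁻¹) {X : LinkDiagram →₀ Poly}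
    (hX : SkeinRelation X) : X.sum (fun D r => specialize x y r * stateSum q c D) = 0 := by
  -- The specialization makes `K` a module over `Poly`, so that the state sum extends to a
  -- `Poly`-linear map on combinations of diagrams.
  let : Module Poly K := Module.compHom K (specialize x y)
  have e : ∀ X : LinkDiagram →₀ Poly, X.sum (fun D r => specialize x y r * stateSum q c D) =
    Finsupp.linearCombination Poly (stateSum q c) X := fun X => rfl
  have e1 : ∀ (r : Poly) (k : K), r • k = specialize x y r * k := fun _ _ => rfl
  have hx' : ((x ^ (-1 : ℤ) : Kˣ) : K) = q ^ (N : ℤ) := by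
    simp [hx]
  have smul_one : ∀ (u w : List Slice) (A : List Bool) (r : K),
      (tangleOp (N := N) q u * (addStrand ^ A.length) (r • 1) * tangleOp q w) =
        r • tangleOp q (u ++ w) := by
    intro u w A r
    rw [map_smul, map_one, mul_smul_comm, mul_one, smul_mul_assoc, tangleOp_append]
  rw [e]
  cases hX with
  | regular hab h =>
    obtain ⟨u, w, A, B, h1, h2⟩ := h
    simp only [single, map_sub, Finsupp.linearCombination_single, e1, map_one, one_mul, stateSum, h1, h2,
      tangleOp_append, tangleOp_whisker, tangleOp_eq_of_regularMove hq hab, sub_self]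
  | skein h =>
    obtain ⟨u, w, A, B, h1, h2, h3⟩ := h
    simp only [single, map_sub, Finsupp.linearCombination_single, e1, map_one, one_mul, stateSum, h1, h2, h3,
      map_smul, specialize_z, hy]
    have := congrFun (congrArg (fun T => T (fun _ => (1 : K)))
      (tangleOp_skein (N := N) q u w A B)) (Stream'.const c)
    exact sub_eq_zero.2 this
  | @kink_pos K' D h =>
    have h0 : tangleOp (N := N) q K'.slices = q ^ (N : ℤ) • tangleOp q D.slices := by
      rcases h with ⟨u, w, A, B, h1, h2⟩ | ⟨u, w, A, B, h1, h2⟩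
      · rw [h1, h2, tangleOp_append, tangleOp_append, tangleOp_whisker, tangleOp_kinkBelow hq,
          smul_one]
        simp [whisker]
      · rw [h1, h2, tangleOp_append, tangleOp_append, tangleOp_whisker, tangleOp_kinkAbove hq,
          smul_one]
        simp [whisker]
    simp only [single, map_sub, Finsupp.linearCombination_single, e1, map_one, one_mul, stateSum, h0,
      map_smul, specialize_v, hx']
    exact sub_self _
  | @kink_neg K' D h =>
    have h0 : tangleOp (N := N) q K'.slices = q ^ (-(N : ℤ)) • tangleOp q D.slices := by
      rcases h with ⟨u, w, A, B, h1, h2⟩ | ⟨u, w, A, B, h1, h2⟩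
      · rw [h1, h2, tangleOp_append, tangleOp_append, tangleOp_whisker,
          tangleOp_kinkBelow_false hq, smul_one]
        simp [whisker]
      · rw [h1, h2, tangleOp_append, tangleOp_append, tangleOp_whisker,
          tangleOp_kinkAbove_false hq, smul_one]
        simp [whisker]
    simp only [single, map_sub, Finsupp.linearCombination_single, e1, map_one, one_mul, stateSum, h0,
      map_smul, specialize_v, zpow_one, hx]
    exact sub_self _
  | unknot =>
    have hz : q - q⁻¹ ≠ 0 := hy ▸ y.ne_zero
    have : ∑ e : Fin N, arcWeight q e = ∑ e : Fin N, (arcWeight q e)⁻¹ := by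
      apply mul_left_cancel₀ hz
      rw [mul_sum_arcWeight hq, mul_sum_arcWeight_inv hq]
    simp only [single, map_sub, Finsupp.linearCombination_single, e1, map_one, one_mul, stateSum]
    simp [unknot, LinkDiagram.slices, tangleOp_cons, tangleOp_nil, pieceOp, this]

/-- For real `q > 1` and at least one colour, the unknot has a positive state sum, which can be
cancelled. -/
theorem specialize_eq_zero {p : Poly} (hp : p • skeinClass (unknot true) = 0) (q : ℝ)
    (hq1 : 1 < q) (hN : 0 < N) {x y : ℝˣ} (hx : (x : ℝ) = q ^ (-(N : ℤ)))
    (hy : (y : ℝ) = q - q⁻¹) : specialize x y p = 0 := by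
  have hq : q ≠ 0 := by positivity
  let c : Fin N := ⟨0, hN⟩
  let : Module Poly ℝ := Module.compHom ℝ (specialize x y)
  let L : (LinkDiagram →₀ Poly) →ₗ[Poly] ℝ := Finsupp.linearCombination Poly (stateSum q c)
  have hL : Submodule.span Poly {x | SkeinRelation x} ≤ LinearMap.ker L := by
    rw [Submodule.span_le]
    exact fun X hX => stateSum_relation c hq hx hy hX
  have h : L (p • single (unknot true)) = 0 := by
    refine hL ((Submodule.Quotient.mk_eq_zero _).1 ?_)
    rw [Submodule.Quotient.mk_smul]
    exact hp
  have h2 : specialize x y p * stateSum q c (unknot true) = 0 := by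
    rw [map_smul, single, Finsupp.linearCombination_single, one_smul] at h
    exact h
  have h3 : stateSum q c (unknot true) = ∑ e : Fin N, arcWeight q e := by
    simp [stateSum, unknot, LinkDiagram.slices, tangleOp_cons, tangleOp_nil, pieceOp]
  have h4 : 0 < ∑ e : Fin N, arcWeight q e :=
    Finset.sum_pos (fun e _ => by unfold arcWeight; positivity) ⟨c, Finset.mem_univ _⟩
  rw [h3] at h2
  exact (mul_eq_zero.1 h2).resolve_right h4.ne'

/-- The class of the unknot generates a free module. -/
theorem eq_zero_of_smul_unknot {p : Poly} (hp : p • skeinClass (unknot true) = 0) : p = 0 := by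
  have hpos : ∀ m : ℕ, (0 : ℝ) < (m + 2 : ℝ) - (m + 2 : ℝ)⁻¹ := by
    intro m
    have : (m + 2 : ℝ)⁻¹ ≤ 1 := inv_le_one_of_one_le₀ (by linarith [(m.cast_nonneg : (0 : ℝ) ≤ m)])
    linarith [(m.cast_nonneg : (0 : ℝ) ≤ m)]
  let Y : ℕ → ℝˣ := fun m => Units.mk0 _ (hpos m).ne'
  have hY : Function.Injective Y := by
    refine Function.Injective.of_comp (f := Units.val) (StrictMono.injective fun a b hab => ?_)
    have h1 : (a : ℝ) < b := by exact_mod_cast hab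
    have h2 : (b + 2 : ℝ)⁻¹ < (a + 2 : ℝ)⁻¹ := inv_strictAnti₀ (by positivity) (by linarith)
    simp only [Function.comp_apply, Y, Units.val_mk0]
    linarith
  refine LaurentPolynomial.ext fun n => LaurentPolynomial.ext fun k => ?_
  -- With q = m + 2 fixed, z is fixed, while v = q^{-N} takes infinitely many values as the number N
  -- ≥ 1 of colours varies. Hence each coefficient in v vanishes at this z. Afterwards `m` varies
  -- and z takes infinitely many values.
  have h0 : ∀ m : ℕ, LaurentPolynomial.eval₂ (Int.castRingHom ℝ) (Y m) (p.coeff n) = 0 := by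
    intro m
    have hm1 : (1 : ℝ) < m + 2 := by linarith [(m.cast_nonneg : (0 : ℝ) ≤ m)]
    have hm0 : (m + 2 : ℝ) ≠ 0 := by positivity
    let X : ℕ → ℝˣ := fun N => Units.mk0 ((m + 2 : ℝ) ^ (-((N + 1 : ℕ) : ℤ))) (zpow_ne_zero _ hm0)
    have hX : Function.Injective X := by
      intro a b hab
      have : (m + 2 : ℝ) ^ (-((a + 1 : ℕ) : ℤ)) = (m + 2 : ℝ) ^ (-((b + 1 : ℕ) : ℤ)) :=
        congrArg Units.val hab
      have := zpow_right_injective₀ (by positivity) hm1.ne' this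
      simpa using this
    refine map_coeff_eq_zero_of_eval₂ _ p (Set.infinite_range_of_injective hX) ?_ n
    rintro _ ⟨N, rfl⟩
    exact specialize_eq_zero hp (m + 2 : ℝ) hm1 (Nat.succ_pos N) rfl rfl
  have := map_coeff_eq_zero_of_eval₂ _ _ (Set.infinite_range_of_injective hY)
    (by rintro _ ⟨m, rfl⟩; exact h0 m) k
  simpa using this

/-! ## Closed braids in the skein module -/

theorem skeinClass_eq_of_regularMove {a b : List Slice} {D D' : LinkDiagram}
    (hab : RegularMove a b) (h : DifferBy a b D D') : skeinClass D = skeinClass D' :=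
  (Submodule.Quotient.eq _).2 (Submodule.subset_span (SkeinRelation.regular hab h))

theorem skeinClass_sub_of_skein {P N S : LinkDiagram} (u w : List Slice) (A B : List Bool)
    (hP : P.slices = u ++ whisker A [⟨[], .cross true, []⟩] B ++ w)
    (hN : N.slices = u ++ whisker A [⟨[], .cross false, []⟩] B ++ w)
    (hS : S.slices = u ++ w) : skeinClass P - skeinClass N = z • skeinClass S := by
  refine (Submodule.Quotient.eq (x := single P - single N) (y := z • single S) _).2
    (Submodule.subset_span (SkeinRelation.skein ⟨u, w, A, B, hP, hN, hS⟩))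

theorem skeinClass_kink (c : Bool) {K D : LinkDiagram} (h : DifferBy (kinkAbove c) [] K D) :
    skeinClass K = v (if c then -1 else 1) • skeinClass D := by
  cases c
  · exact (Submodule.Quotient.eq (x := single K) (y := v 1 • single D) _).2
      (Submodule.subset_span (SkeinRelation.kink_neg (Or.inr h)))
  · exact (Submodule.Quotient.eq (x := single K) (y := v (-1) • single D) _).2
      (Submodule.subset_span (SkeinRelation.kink_pos (Or.inr h)))

theorem skeinClass_unknot_false : skeinClass (unknot false) = skeinClass (unknot true) :=
  ((Submodule.Quotient.eq _).2 (Submodule.subset_span SkeinRelation.unknot)).symm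

theorem braidPart_append {n : ℕ} (a b : BraidWord n) :
    braidPart (a ++ b) = braidPart a ++ braidPart b := List.map_append

theorem closure_slices {n : ℕ} (a : BraidWord n) :
    a.closure.slices = openArcs n ++ braidPart a ++ closeArcs n := rfl

theorem skeinClass_closure_eq {n : ℕ} {a b : BraidWord n} {a' b' : List Slice} {A B : List Bool}
    (ha : braidPart a = whisker A a' B) (hb : braidPart b = whisker A b' B)
    (hab : RegularMove a' b') (u w : BraidWord n) :
    skeinClass (BraidWord.closure (u ++ a ++ w)) = skeinClass (BraidWord.closure (u ++ b ++ w)) := by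
  refine skeinClass_eq_of_regularMove hab
    ⟨openArcs n ++ braidPart u, braidPart w ++ closeArcs n, A, B, ?_, ?_⟩
  · simp [closure_slices, braidPart_append, ← ha]
  · simp [closure_slices, braidPart_append, ← hb]

theorem closure_cancel {n : ℕ} (i : Fin (n - 1)) (c : Bool) (u w : BraidWord n) :
    skeinClass (BraidWord.closure (u ++ [(i, c), (i, !c)] ++ w)) =
      skeinClass (BraidWord.closure (u ++ [] ++ w)) :=
  skeinClass_closure_eq (A := List.replicate n false ++ List.replicate i.val true)
    (B := List.replicate (n - 2 - i.val) true) (by simp [braidPart, whisker])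
    (by simp [braidPart, whisker]) (RegularMove.reidemeister_two c) u w

theorem closure_commute {n : ℕ} (i j : Fin (n - 1)) (hij : i.val + 1 < j.val) (c d : Bool)
    (u w : BraidWord n) :
    skeinClass (BraidWord.closure (u ++ [(i, c), (j, d)] ++ w)) =
      skeinClass (BraidWord.closure (u ++ [(j, d), (i, c)] ++ w)) := by
  have hj := j.isLt
  have e1 : List.replicate (n - 2 - i.val) true = List.replicate (j.val - i.val - 2) true ++
      [true, true] ++ List.replicate (n - 2 - j.val) true := by
    rw [show [true, true] = List.replicate 2 true from rfl]
    simp only [List.replicate_append_replicate]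
    congr 1; omega
  have e2 : List.replicate j.val true = List.replicate i.val true ++ [true, true] ++
      List.replicate (j.val - i.val - 2) true := by
    rw [show [true, true] = List.replicate 2 true from rfl]
    simp only [List.replicate_append_replicate]
    congr 1; omega
  refine skeinClass_closure_eq (A := List.replicate n false ++ List.replicate i.val true)
    (B := List.replicate (n - 2 - j.val) true) ?_ ?_
    (RegularMove.exchange (.cross c) (.cross d) (List.replicate (j.val - i.val - 2) true)) u w
  · simp only [braidPart, List.map_cons, List.map_nil, e1, e2]
    simp [whisker, Piece.dom, Piece.cod]
  · simp only [braidPart, List.map_cons, List.map_nil, e1, e2]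
    simp [whisker, Piece.dom, Piece.cod]

theorem closure_braid {n : ℕ} (i j : Fin (n - 1)) (hij : i.val + 1 = j.val) (c : Bool)
    (u w : BraidWord n) :
    skeinClass (BraidWord.closure (u ++ [(i, c), (j, c), (i, c)] ++ w)) =
      skeinClass (BraidWord.closure (u ++ [(j, c), (i, c), (j, c)] ++ w)) := by
  have hj := j.isLt
  have e1 : List.replicate (n - 2 - i.val) true =
      [true] ++ List.replicate (n - 2 - j.val) true := by
    rw [show n - 2 - i.val = n - 2 - j.val + 1 by omega, List.replicate_succ]; rfl
  have e2 : List.replicate j.val true = List.replicate i.val true ++ [true] := by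
    rw [← hij, List.replicate_succ']
  refine skeinClass_closure_eq (A := List.replicate n false ++ List.replicate i.val true)
    (B := List.replicate (n - 2 - j.val) true) ?_ ?_ (RegularMove.reidemeister_three c) u w
  · simp only [braidPart, List.map_cons, List.map_nil, e1, e2]
    simp [whisker]
  · simp only [braidPart, List.map_cons, List.map_nil, e1, e2]
    simp [whisker]

theorem closure_skein {n : ℕ} (i : Fin (n - 1)) (u w : BraidWord n) :
    skeinClass (BraidWord.closure (u ++ [(i, true)] ++ w)) -
      skeinClass (BraidWord.closure (u ++ [(i, false)] ++ w)) =
        z • skeinClass (BraidWord.closure (u ++ w)) := by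
  refine skeinClass_sub_of_skein (openArcs n ++ braidPart u) (braidPart w ++ closeArcs n)
    (List.replicate n false ++ List.replicate i.val true) (List.replicate (n - 2 - i.val) true)
    ?_ ?_ ?_ <;> simp [closure_slices, braidPart, whisker]

/-- Two braid words that can replace each other in every closed braid word. -/
def closureCon (n : ℕ) : Con (FreeMonoid (Fin (n - 1) × Bool)) where
  r a b := ∀ u w : BraidWord n, skeinClass (BraidWord.closure (u ++ a.toList ++ w)) =
    skeinClass (BraidWord.closure (u ++ b.toList ++ w))
  iseqv := ⟨fun _ _ _ => rfl, fun h u w => (h u w).symm, fun h h' u w => (h u w).trans (h' u w)⟩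
  mul' := by
    intro a b c d hab hcd u w
    have h1 := hab u (c.toList ++ w)
    have h2 := hcd (u ++ b.toList) w
    simp only [List.append_assoc, FreeMonoid.toList_mul] at h1 h2 ⊢
    exact h1.trans h2

/-- The class of a letter. -/
def letterClass {n : ℕ} (x : Fin (n - 1) × Bool) : (closureCon n).Quotient :=
  (closureCon n).mk' (FreeMonoid.of x)

theorem letterClass_mul_not {n : ℕ} (i : Fin (n - 1)) (c : Bool) :
    letterClass (n := n) (i, c) * letterClass (i, !c) = 1 :=
  (Con.eq _).2 fun u w => closure_cancel i c u w

/-- The class of a generator. -/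
def generatorClass {n : ℕ} (i : Fin (n - 1)) : (closureCon n).Quotientˣ :=
  ⟨letterClass (i, true), letterClass (i, false), letterClass_mul_not i true,
    letterClass_mul_not i false⟩

/-- Letters are already invertible modulo `closureCon` by the second Reidemeister move, so relations
between positive letters suffice: planar exchange for distant ones, the third Reidemeister move for
neighbours. -/
theorem lift_generatorClass {n : ℕ} (r : FreeGroup (Fin (n - 1))) (hr : r ∈ braidRelations n) :
    FreeGroup.lift (generatorClass (n := n)) r = 1 := by
  rcases hr with ⟨i, j, hij, rfl⟩ | ⟨i, j, hij, rfl⟩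
  · simp only [map_mul, map_inv, FreeGroup.lift_apply_of, mul_inv_eq_one]
    exact Units.ext ((Con.eq _).2 fun u w => closure_commute i j hij true true u w)
  · simp only [map_mul, map_inv, FreeGroup.lift_apply_of, mul_inv_eq_one]
    exact Units.ext ((Con.eq _).2 fun u w => closure_braid i j hij true u w)

/-- The class of a word modulo `closureCon` factors through the braid group, so words for the same
braid are interchangeable inside every closure. -/
theorem toGroup_toBraid {n : ℕ} (w : BraidWord n) :
    (PresentedGroup.toGroup (lift_generatorClass (n := n)) w.toBraid : (closureCon n).Quotient) =
      (closureCon n).mk' (FreeMonoid.ofList w) := by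
  induction w with
  | nil => simp [BraidWord.toBraid]
  | cons x w ih =>
    have e : BraidWord.toBraid (x :: w) =
        (if x.2 then sigma x.1 else (sigma x.1)⁻¹) * BraidWord.toBraid w := by
      simp [BraidWord.toBraid]
    rw [e, map_mul, Units.val_mul, ih, FreeMonoid.ofList_cons, map_mul]
    congr 1
    obtain ⟨i, c⟩ := x
    cases c
    · simp [sigma, generatorClass, letterClass]
    · simp [sigma, generatorClass, letterClass]

/-- The class of a closed braid word depends only on the braid. -/
theorem skeinClass_closure_congr {n : ℕ} {a b : BraidWord n} (h : a.toBraid = b.toBraid) :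
    skeinClass a.closure = skeinClass b.closure := by
  have h1 : (closureCon n).mk' (FreeMonoid.ofList a) = (closureCon n).mk' (FreeMonoid.ofList b) := by
    rw [← toGroup_toBraid, ← toGroup_toBraid, h]
  have := (Con.eq _).1 h1 [] []
  simpa using this

theorem toBraid_append {n : ℕ} (a b : BraidWord n) :
    BraidWord.toBraid (a ++ b) = a.toBraid * b.toBraid := by
  simp [BraidWord.toBraid]

theorem toBraid_surjective (n : ℕ) : Function.Surjective (BraidWord.toBraid (n := n)) := by
  intro β
  induction β using PresentedGroup.induction_on with
  | _ g =>
    induction g using FreeGroup.induction_on with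
    | C1 => exact ⟨[], by simp [BraidWord.toBraid]⟩
    | of i => exact ⟨[(i, true)], by simp [BraidWord.toBraid, sigma, PresentedGroup.of]⟩
    | inv_of i _ => exact ⟨[(i, false)], by simp [BraidWord.toBraid, sigma, PresentedGroup.of]⟩
    | mul x y hx hy =>
      obtain ⟨a, ha⟩ := hx
      obtain ⟨b, hb⟩ := hy
      exact ⟨a ++ b, by rw [toBraid_append, ha, hb, map_mul]⟩

/-- The class of the closure of a braid. -/
noncomputable def closureClass {n : ℕ} (β : BraidGroup n) : SkeinModule :=
  skeinClass (BraidWord.closure (toBraid_surjective n β).choose)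

theorem closureClass_toBraid {n : ℕ} (w : BraidWord n) :
    closureClass w.toBraid = skeinClass w.closure :=
  skeinClass_closure_congr (toBraid_surjective n w.toBraid).choose_spec

theorem closureClass_skein {n : ℕ} (i : Fin (n - 1)) (x y : BraidGroup n) :
    closureClass (x * sigma i * y) - closureClass (x * (sigma i)⁻¹ * y) =
      z • closureClass (x * y) := by
  obtain ⟨a, rfl⟩ := toBraid_surjective n x
  obtain ⟨b, rfl⟩ := toBraid_surjective n y
  have e1 : sigma i = BraidWord.toBraid (n := n) [(i, true)] := by simp [BraidWord.toBraid]
  have e2 : (sigma i)⁻¹ = BraidWord.toBraid (n := n) [(i, false)] := by simp [BraidWord.toBraid]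
  rw [e2, e1]
  simp only [← toBraid_append, closureClass_toBraid]
  exact closure_skein i a b

/-! ## Removing a strand -/

/-- The class of a sequence of slices, zero unless they form a link diagram. -/
noncomputable def slicesClass (w : List Slice) : SkeinModule :=
  open Classical in if h : IsTangle [] w [] then skeinClass ⟨w, h⟩ else 0

theorem slicesClass_eq {a b : List Slice} (hab : RegularMove a b) (A B : List Bool)
    {u w : List Slice} (h1 : IsTangle [] (u ++ whisker A a B ++ w) [])
    (h2 : IsTangle [] (u ++ whisker A b B ++ w) []) :
    slicesClass (u ++ whisker A a B ++ w) = slicesClass (u ++ whisker A b B ++ w) := by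
  rw [slicesClass, slicesClass, dif_pos h1, dif_pos h2]
  exact skeinClass_eq_of_regularMove hab ⟨u, w, A, B, rfl, rfl⟩

/-- The strands of a closed braid diagram. -/
def closedStrands (k : ℕ) : List Bool := List.replicate k false ++ List.replicate k true

/-- The innermost closing arc, at its left end. -/
def innerCup (k : ℕ) : Slice := ⟨List.replicate k false, .cup false, List.replicate k true⟩

/-- The innermost closing arc, at its right end. -/
def innerCap (k : ℕ) : Slice := ⟨List.replicate k false, .cap false, List.replicate k true⟩

theorem closedStrands_succ (k : ℕ) : closedStrands (k + 1) =
    List.replicate k false ++ [false, true] ++ List.replicate k true := by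
  rw [closedStrands, List.replicate_succ' (a := false), List.replicate_succ (a := true)]
  simp

theorem isTangle_innerCup (k : ℕ) : IsTangle (closedStrands k) [innerCup k]
    (closedStrands (k + 1)) := by
  rw [closedStrands_succ]
  simp [IsTangle, innerCup, Slice.dom, Slice.cod, Piece.dom, Piece.cod, closedStrands]

theorem isTangle_innerCap (k : ℕ) : IsTangle (closedStrands (k + 1)) [innerCap k]
    (closedStrands k) := by
  rw [closedStrands_succ]
  simp [IsTangle, innerCap, Slice.dom, Slice.cod, Piece.dom, Piece.cod, closedStrands]

theorem openArcs_succ (k : ℕ) : openArcs (k + 1) = openArcs k ++ [innerCup k] := by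
  simp [openArcs, List.range_succ, innerCup]

theorem closeArcs_succ (k : ℕ) : closeArcs (k + 1) = innerCap k :: closeArcs k := by
  simp [closeArcs, List.range_succ, innerCap]

/-- A braid word with a strand added above it. -/
def shiftWord {k : ℕ} (w : BraidWord (k + 1)) : BraidWord (k + 2) :=
  w.map fun x => (⟨x.1.val + 1, by have := x.1.isLt; omega⟩, x.2)

/-- All crossings of the shifted word lie below the innermost arc, so its left end moves to the
right past them, one planar exchange per letter. -/
theorem slicesClass_slide_cup {k : ℕ} (x : BraidWord (k + 1)) (u w : List Slice)
    (hu : IsTangle [] u (closedStrands (k + 1))) (hw : IsTangle (closedStrands (k + 2)) w []) :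
    slicesClass (u ++ innerCup (k + 1) :: (braidPart (shiftWord x) ++ w)) =
      slicesClass (u ++ (braidPart x ++ innerCup (k + 1) :: w)) := by
  induction x generalizing u with
  | nil => rfl
  | cons y x ih =>
    obtain ⟨⟨i, hi⟩, c⟩ := y
    have h1 : IsTangle [] (u ++ innerCup (k + 1) ::
        (braidPart (shiftWord ((⟨i, hi⟩, c) :: x)) ++ w)) [] :=
      hu.append ((isTangle_innerCup (k + 1)).append
        ((isTangle_braidPart (shiftWord ((⟨i, hi⟩, c) :: x))).append hw))
    have hy : IsTangle (closedStrands (k + 1)) (braidPart (n := k + 1) [(⟨i, hi⟩, c)])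
      (closedStrands (k + 1)) := isTangle_braidPart _
    have hu' := hu.append hy
    have h2 := hu'.append ((isTangle_innerCup (k + 1)).append
      ((isTangle_braidPart (shiftWord x)).append hw))
    have e0 : List.replicate (k + 1) true = List.replicate i true ++ [true, true] ++
        List.replicate (k - 1 - i) true := by
      rw [show [true, true] = List.replicate 2 true from rfl]
      simp only [List.replicate_append_replicate]
      congr 1; omega
    have e1 : u ++ innerCup (k + 1) :: (braidPart (shiftWord ((⟨i, hi⟩, c) :: x)) ++ w) =
        u ++ whisker (List.replicate (k + 1) false) [⟨[], .cup false, List.replicate i true ++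
          Piece.dom (.cross c)⟩, ⟨Piece.cod (.cup false) ++ List.replicate i true, .cross c, []⟩]
          (List.replicate (k - 1 - i) true) ++ (braidPart (shiftWord x) ++ w) := by
      simp only [innerCup, e0]
      simp [shiftWord, braidPart, whisker, Piece.dom, Piece.cod, List.replicate_succ' (a := false),
        List.replicate_succ (a := true)]
      omega
    have e2 : u ++ braidPart (n := k + 1) [(⟨i, hi⟩, c)] ++
        ([innerCup (k + 1)] ++ (braidPart (shiftWord x) ++ w)) =
        u ++ whisker (List.replicate (k + 1) false) [⟨Piece.dom (.cup false) ++
          List.replicate i true, .cross c, []⟩, ⟨[], .cup false, List.replicate i true ++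
          Piece.cod (.cross c)⟩]
          (List.replicate (k - 1 - i) true) ++ (braidPart (shiftWord x) ++ w) := by
      simp only [innerCup, e0]
      simp [braidPart, whisker, Piece.dom, Piece.cod]
    have e3 : slicesClass (u ++ innerCup (k + 1) ::
        (braidPart (shiftWord ((⟨i, hi⟩, c) :: x)) ++ w)) =
        slicesClass (u ++ braidPart (n := k + 1) [(⟨i, hi⟩, c)] ++
        ([innerCup (k + 1)] ++ (braidPart (shiftWord x) ++ w))) := by
      rw [e1] at h1 ⊢
      rw [e2] at h2 ⊢
      exact slicesClass_eq (RegularMove.exchange _ _ _) _ _ h1 h2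
    rw [e3, List.singleton_append, ih _ hu']
    simp [braidPart]

theorem slicesClass_slide_cap {k : ℕ} (x : BraidWord (k + 1)) (u w : List Slice)
    (hu : IsTangle [] u (closedStrands (k + 2))) (hw : IsTangle (closedStrands (k + 1)) w []) :
    slicesClass (u ++ (braidPart (shiftWord x) ++ innerCap (k + 1) :: w)) =
      slicesClass (u ++ innerCap (k + 1) :: (braidPart x ++ w)) := by
  induction x generalizing u with
  | nil => rfl
  | cons y x ih =>
    obtain ⟨⟨i, hi⟩, c⟩ := y
    have hy : IsTangle (closedStrands (k + 2)) (braidPart (shiftWord [(⟨i, hi⟩, c)]))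
      (closedStrands (k + 2)) := isTangle_braidPart _
    have hu' := hu.append hy
    have h1 : IsTangle [] (u ++ innerCap (k + 1) ::
        (braidPart ((⟨i, hi⟩, c) :: x) ++ w)) [] :=
      hu.append ((isTangle_innerCap (k + 1)).append
        ((isTangle_braidPart (n := k + 1) ((⟨i, hi⟩, c) :: x)).append hw))
    have h2 := hu'.append ((isTangle_innerCap (k + 1)).append
      ((isTangle_braidPart x).append hw))
    have e0 : List.replicate (k + 1) true = List.replicate i true ++ [true, true] ++
        List.replicate (k - 1 - i) true := by
      rw [show [true, true] = List.replicate 2 true from rfl]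
      simp only [List.replicate_append_replicate]
      congr 1; omega
    have e1 : u ++ innerCap (k + 1) :: (braidPart ((⟨i, hi⟩, c) :: x) ++ w) =
        u ++ whisker (List.replicate (k + 1) false) [⟨[], .cap false, List.replicate i true ++
          Piece.dom (.cross c)⟩, ⟨Piece.cod (.cap false) ++ List.replicate i true, .cross c, []⟩]
          (List.replicate (k - 1 - i) true) ++ (braidPart x ++ w) := by
      simp only [innerCap, e0]
      simp [braidPart, whisker, Piece.dom, Piece.cod]
    have e2 : u ++ braidPart (shiftWord [(⟨i, hi⟩, c)]) ++
        ([innerCap (k + 1)] ++ (braidPart x ++ w)) =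
        u ++ whisker (List.replicate (k + 1) false) [⟨Piece.dom (.cap false) ++
          List.replicate i true, .cross c, []⟩, ⟨[], .cap false, List.replicate i true ++
          Piece.cod (.cross c)⟩]
          (List.replicate (k - 1 - i) true) ++ (braidPart x ++ w) := by
      simp only [innerCap, e0]
      simp [shiftWord, braidPart, whisker, Piece.dom, Piece.cod, List.replicate_succ' (a := false),
        List.replicate_succ (a := true)]
      omega
    have e3 : slicesClass (u ++ braidPart (shiftWord [(⟨i, hi⟩, c)]) ++
        ([innerCap (k + 1)] ++ (braidPart x ++ w))) = slicesClass (u ++ innerCap (k + 1) ::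
        (braidPart ((⟨i, hi⟩, c) :: x) ++ w)) := by
      rw [e1] at h1 ⊢
      rw [e2] at h2 ⊢
      exact (slicesClass_eq (RegularMove.exchange _ _ _) _ _ h1 h2).symm
    rw [← e3, List.singleton_append, ← ih _ hu']
    simp [braidPart, shiftWord]

/-- Once both ends of the innermost arc have been slid up to the single crossing of the first two
strands, arc and crossing form a kink above the top strand of the closure of `x ++ y`. -/
theorem skeinClass_closure_stabilization {k : ℕ} (c : Bool) (x y : BraidWord (k + 1)) :
    skeinClass (BraidWord.closure (shiftWord x ++ [(⟨0, by omega⟩, c)] ++ shiftWord y)) =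
      v (if c then -1 else 1) • skeinClass (BraidWord.closure (x ++ y)) := by
  have hx : IsTangle [] (openArcs (k + 1) ++ braidPart x) (closedStrands (k + 1)) :=
    (isTangle_openArcs _).append (isTangle_braidPart x)
  have hy : IsTangle (closedStrands (k + 1)) (braidPart y ++ closeArcs (k + 1)) [] :=
    (isTangle_braidPart y).append (isTangle_closeArcs _)
  let X : BraidWord (k + 2) := [(⟨0, by omega⟩, c)]
  have hX : IsTangle (closedStrands (k + 2)) (braidPart X) (closedStrands (k + 2)) :=
    isTangle_braidPart X
  have h1 := hx.append ((isTangle_innerCup (k + 1)).append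
    (hX.append ((isTangle_innerCap (k + 1)).append hy)))
  have e1 : skeinClass (BraidWord.closure (shiftWord x ++ X ++ shiftWord y)) =
      slicesClass (openArcs (k + 1) ++ innerCup (k + 1) :: (braidPart (shiftWord x) ++
        (braidPart X ++ (braidPart (shiftWord y) ++ innerCap (k + 1) :: closeArcs (k + 1))))) := by
    have h := (BraidWord.closure (shiftWord x ++ X ++ shiftWord y)).2
    have e : (BraidWord.closure (shiftWord x ++ X ++ shiftWord y)).1 =
      openArcs (k + 1) ++ innerCup (k + 1) :: (braidPart (shiftWord x) ++
        (braidPart X ++ (braidPart (shiftWord y) ++ innerCap (k + 1) :: closeArcs (k + 1)))) := by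
      change openArcs (k + 2) ++ braidPart _ ++ closeArcs (k + 2) = _
      rw [braidPart_append, braidPart_append, openArcs_succ (k + 1),
        closeArcs_succ (k + 1)]
      simp only [List.append_assoc, List.cons_append, List.nil_append]
    rw [← e, slicesClass, dif_pos h]
    rfl
  have h2 : IsTangle (closedStrands (k + 2)) (braidPart X ++ (braidPart (shiftWord y) ++
      innerCap (k + 1) :: closeArcs (k + 1))) [] :=
    hX.append ((isTangle_braidPart _).append
      ((isTangle_innerCap (k + 1)).append (isTangle_closeArcs _)))
  rw [e1, slicesClass_slide_cup x _ _ (isTangle_openArcs _) h2]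
  have h3 := slicesClass_slide_cap y (openArcs (k + 1) ++ braidPart x ++ [innerCup (k + 1)] ++
    braidPart X) (closeArcs (k + 1)) ((hx.append (isTangle_innerCup _)).append hX)
    (isTangle_closeArcs _)
  have e2 : openArcs (k + 1) ++ (braidPart x ++ innerCup (k + 1) :: (braidPart X ++
      (braidPart (shiftWord y) ++ innerCap (k + 1) :: closeArcs (k + 1)))) =
      openArcs (k + 1) ++ braidPart x ++ [innerCup (k + 1)] ++ braidPart X ++
      (braidPart (shiftWord y) ++ innerCap (k + 1) :: closeArcs (k + 1)) := by simp
  have e3 : openArcs (k + 1) ++ braidPart x ++ [innerCup (k + 1)] ++ braidPart X ++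
      innerCap (k + 1) :: (braidPart y ++ closeArcs (k + 1)) =
      openArcs (k + 1) ++ braidPart x ++ ([innerCup (k + 1)] ++ (braidPart X ++
        ([innerCap (k + 1)] ++ (braidPart y ++ closeArcs (k + 1))))) := by simp
  rw [e2, h3, e3, slicesClass, dif_pos h1]
  refine skeinClass_kink c ⟨openArcs (k + 1) ++ braidPart x, braidPart y ++ closeArcs (k + 1),
    List.replicate (k + 1) false, List.replicate k true, ?_, ?_⟩
  · simp [LinkDiagram.slices, whisker, kinkAbove, innerCup, innerCap, X, braidPart,
      List.replicate_succ' (a := false), List.replicate_succ (a := true)]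
  · simp [closure_slices, whisker, braidPart_append]

/-! ## The generators of the braid group -/

theorem ascProd_map {G H : Type*} [Group G] [Group H] (f : G →* H) (t : ℕ → G) (m : ℕ) :
    f (ascProd t m) = ascProd (fun i => f (t i)) m := by
  induction m with
  | zero => exact map_one f
  | succ m ih => rw [ascProd, map_mul, ih, ascProd]

theorem descProd_map {G H : Type*} [Group G] [Group H] (f : G →* H) (t : ℕ → G) (m : ℕ) :
    f (descProd t m) = descProd (fun i => f (t i)) m := by
  induction m with
  | zero => exact map_one f
  | succ m ih => rw [descProd, map_mul, ih, descProd]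

theorem halfTwist_map {G H : Type*} [Group G] [Group H] (f : G →* H) (t : ℕ → G) (m : ℕ) :
    f (halfTwist t m) = halfTwist (fun i => f (t i)) m := by
  induction m with
  | zero => exact map_one f
  | succ m ih => rw [halfTwist, map_mul, ih, ascProd_map, halfTwist]

/-- The standard generators of the braid group on `k + 1` strands, continued by `1`. -/
def gen (k : ℕ) (i : ℕ) : BraidGroup (k + 1) :=
  if h : i < k then sigma ⟨i, h⟩ else 1

theorem gen_val {k : ℕ} (i : Fin (k + 1 - 1)) : gen k i.val = sigma i := dif_pos i.isLt

theorem isBraidSequence_gen (k : ℕ) : IsBraidSequence (gen k) k := by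
  refine ⟨fun i j hij hj => ?_, fun i hi => ?_⟩
  · rw [gen, gen, dif_pos (by omega), dif_pos hj]
    exact PresentedGroup.mk_eq_mk_of_mul_inv_mem
      (Or.inl ⟨⟨i, by omega⟩, ⟨j, hj⟩, hij, rfl⟩)
  · rw [gen, gen, dif_pos (by omega), dif_pos hi]
    exact PresentedGroup.mk_eq_mk_of_mul_inv_mem
      (Or.inr ⟨⟨i, by omega⟩, ⟨i + 1, hi⟩, rfl, rfl⟩)

theorem lift_shift {k : ℕ} (r : FreeGroup (Fin (k + 1 - 1))) (hr : r ∈ braidRelations (k + 1)) :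
    FreeGroup.lift (fun i => gen (k + 1) (i.val + 1)) r = 1 := by
  have h := isBraidSequence_gen (k + 1)
  rcases hr with ⟨i, j, hij, rfl⟩ | ⟨i, j, hij, rfl⟩
  · simp only [map_mul, map_inv, FreeGroup.lift_apply_of, mul_inv_eq_one]
    have := j.isLt
    exact (h.commute _ _ (by omega) (by omega)).eq
  · simp only [map_mul, map_inv, FreeGroup.lift_apply_of, mul_inv_eq_one]
    have := j.isLt
    rw [← hij]
    exact h.braid _ (by omega)

/-- The homomorphism that adds a strand above a braid. -/
def shiftHom (k : ℕ) : BraidGroup (k + 1) →* BraidGroup (k + 2) :=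
  PresentedGroup.toGroup (lift_shift (k := k))

theorem shiftHom_sigma {k : ℕ} (i : Fin (k + 1 - 1)) :
    shiftHom k (sigma i) = gen (k + 1) (i.val + 1) := PresentedGroup.toGroup.of _

theorem shiftHom_gen (k i : ℕ) : shiftHom k (gen k i) = gen (k + 1) (i + 1) := by
  by_cases h : i < k
  · rw [gen, dif_pos h, shiftHom_sigma]
  · rw [gen, dif_neg h, gen, dif_neg (by omega), map_one]

theorem shiftHom_toBraid {k : ℕ} (w : BraidWord (k + 1)) :
    shiftHom k w.toBraid = (shiftWord w).toBraid := by
  induction w with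
  | nil => exact map_one _
  | cons x w ih =>
    have e : ∀ {n : ℕ} (x : Fin (n - 1) × Bool) (w : BraidWord n), BraidWord.toBraid (x :: w) =
        (if x.2 then sigma x.1 else (sigma x.1)⁻¹) * BraidWord.toBraid w := by
      intro n x w
      simp [BraidWord.toBraid]
    have hx := x.1.isLt
    have e2 : shiftWord (x :: w) = (⟨x.1.val + 1, by omega⟩, x.2) :: shiftWord w := rfl
    rw [e2, e, e, map_mul, ih, ← gen_val, ← gen_val]
    obtain ⟨i, c⟩ := x
    cases c
    · simp [shiftHom_gen]
    · simp [shiftHom_gen]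

theorem closureClass_shift {k : ℕ} (x y : BraidGroup (k + 1)) :
    closureClass (shiftHom k x * gen (k + 1) 0 * shiftHom k y) = v (-1) • closureClass (x * y) := by
  obtain ⟨a, rfl⟩ := toBraid_surjective _ x
  obtain ⟨b, rfl⟩ := toBraid_surjective _ y
  have e : gen (k + 1) 0 = BraidWord.toBraid (n := k + 2) [(⟨0, by omega⟩, true)] := by
    simp [BraidWord.toBraid, gen]
  rw [e, shiftHom_toBraid, shiftHom_toBraid, ← toBraid_append, ← toBraid_append, ← toBraid_append,
    closureClass_toBraid, closureClass_toBraid]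
  exact skeinClass_closure_stabilization true a b

theorem closureClass_shift_inv {k : ℕ} (x y : BraidGroup (k + 1)) :
    closureClass (shiftHom k x * (gen (k + 1) 0)⁻¹ * shiftHom k y) =
      v 1 • closureClass (x * y) := by
  obtain ⟨a, rfl⟩ := toBraid_surjective _ x
  obtain ⟨b, rfl⟩ := toBraid_surjective _ y
  have e : (gen (k + 1) 0)⁻¹ = BraidWord.toBraid (n := k + 2) [(⟨0, by omega⟩, false)] := by
    simp [BraidWord.toBraid, gen]
  rw [e, shiftHom_toBraid, shiftHom_toBraid, ← toBraid_append, ← toBraid_append, ← toBraid_append,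
    closureClass_toBraid, closureClass_toBraid]
  exact skeinClass_closure_stabilization false a b

theorem ascProd_eq_prod {G : Type*} [Group G] (t : ℕ → G) (m : ℕ) :
    ascProd t m = ((List.range m).map t).prod := by
  induction m with
  | zero => rfl
  | succ m ih => rw [ascProd, ih, List.range_succ]; simp

theorem halfTwist_eq_prod {G : Type*} [Group G] (t : ℕ → G) (m : ℕ) :
    halfTwist t m = ((List.range m).map fun r => ascProd t (m - 1 - r)).prod := by
  induction m with
  | zero => rfl
  | succ m ih =>
    rw [halfTwist, ih, List.range_succ_eq_map, List.map_cons, List.prod_cons, List.map_map]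
    congr 3
    ext r
    simp only [Function.comp_apply]
    congr 1
    omega

theorem ascending_eq {k m : ℕ} (hm : m ≤ k) : ascending (k + 1) m = ascProd (gen k) m := by
  obtain ⟨d, rfl⟩ := Nat.exists_eq_add_of_le hm
  have e : ((List.finRange (m + d)).filter fun i => i.val < m).map Fin.val = List.range m := by
    have := List.filter_map (f := Fin.val) (p := fun i => decide (i < m)) (l := List.finRange (m + d))
    rw [List.map_coe_finRange_eq_range, List.range_add, List.filter_append] at this
    rw [show (fun i : Fin (m + d) => decide (i.val < m)) =
      (fun i : ℕ => decide (i < m)) ∘ Fin.val from rfl, ← this]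
    rw [List.filter_eq_self.2, List.filter_eq_nil_iff.2, List.append_nil]
    · simp
    · simp
  rw [ascProd_eq_prod, ← e, List.map_map, ascending]
  congr 2
  funext i
  exact (gen_val i).symm

theorem garside_eq (k : ℕ) : garside (k + 1) = halfTwist (gen k) (k + 1) := by
  rw [halfTwist_eq_prod, garside]
  congr 1
  refine List.map_congr_left fun r _ => ?_
  exact ascending_eq (by omega)

theorem subsingleton_braidGroup_one (x : BraidGroup 1) : x = 1 := by
  obtain ⟨w, rfl⟩ := toBraid_surjective 1 x
  cases w with
  | nil => rfl
  | cons x _ => exact x.1.elim0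

/-- In the reversed numbering the first `k` generators are all those other than σ₁, and these are
the shifted ones. -/
theorem exists_shiftHom_eq {k : ℕ} {x : BraidGroup (k + 2)}
    (hx : x ∈ initialSubgroup (fun j => gen (k + 1) (k + 1 - 1 - j)) k) :
    ∃ y, shiftHom k y = x := by
  refine (Subgroup.closure_le (shiftHom k).range).2 ?_ hx
  rintro _ ⟨j, hj, rfl⟩
  have hj' : j < k := hj
  refine ⟨gen k (k - 1 - j), ?_⟩
  rw [shiftHom_gen]
  congr 1
  omega

/-- A function on the braid group that respects the Hecke relations is determined by its values on
braids that involve the first generator at most once. -/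
theorem eq_zero_of_shift {k : ℕ} {R M : Type*} [CommRing R] [AddCommGroup M] [Module R M] (z : R)
    (F : BraidGroup (k + 2) → M)
    (hecke : ∀ (i : Fin (k + 2 - 1)) x y,
      F (x * sigma i * y) - F (x * (sigma i)⁻¹ * y) = z • F (x * y))
    (low : ∀ x, F (shiftHom k x) = 0)
    (high : ∀ x y, F (shiftHom k x * gen (k + 1) 0 * shiftHom k y) = 0)
    (g : BraidGroup (k + 2)) : F g = 0 := by
  have h0 : VanishesOnSpan z (fun j => gen (k + 1) (k + 1 - 1 - j)) k F := by
    refine ⟨fun i hi x y => ?_, fun x hx => ?_, fun x hx y hy => ?_⟩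
    · have := hecke ⟨k + 1 - 1 - i, by omega⟩ x y
      rwa [← gen_val] at this
    · obtain ⟨x, rfl⟩ := exists_shiftHom_eq hx
      exact low x
    · obtain ⟨x, rfl⟩ := exists_shiftHom_eq hx
      obtain ⟨y, rfl⟩ := exists_shiftHom_eq hy
      have := high x y
      simpa using this
  refine h0.eq_zero (isBraidSequence_gen (k + 1)).reverse ?_
  refine PresentedGroup.generated_by _ _ (fun i => ?_) g
  have hi := i.isLt
  have := mem_initialSubgroup (fun j => gen (k + 1) (k + 1 - 1 - j))
    (show k - i.val < k + 1 by omega)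
  have e : gen (k + 1) (k + 1 - 1 - (k - i.val)) = sigma i := by
    rw [← gen_val]
    congr 1
    omega
  rw [sigma] at e
  rw [← e]
  exact this

/-! ## The framed Homfly polynomial of closed braids -/

theorem closureClass_one_strand (β : BraidGroup 1) :
    closureClass β = skeinClass (unknot true) := by
  rw [subsingleton_braidGroup_one β, ← skeinClass_unknot_false]
  exact closureClass_toBraid (n := 1) []

theorem z_mul_inv : LaurentPolynomial.C (LaurentPolynomial.T (-1)) * z = 1 := by
  rw [z, ← map_mul, ← LaurentPolynomial.T_add]
  simp

/-- Inserting σ₁ or σ₁⁻¹ after the shifted braid gives a positive or a negative kink, and their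
skein difference evaluates the additional loop. The factor z stays on the left because the loop
value involves z⁻¹. -/
theorem z_smul_closureClass_shift {k : ℕ} (x : BraidGroup (k + 1)) :
    z • closureClass (shiftHom k x) = (v (-1) - v 1) • closureClass x := by
  have h := closureClass_skein (n := k + 2) ⟨0, by omega⟩ (shiftHom k x) 1
  rw [← gen_val] at h
  have h1 := closureClass_shift x 1
  have h2 := closureClass_shift_inv x 1
  rw [map_one] at h1 h2
  rw [h1, h2, mul_one, mul_one] at h
  rw [← h, sub_smul]

theorem closureClass_mem_span (k : ℕ) (β : BraidGroup (k + 1)) :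
    closureClass β ∈ Submodule.span Poly {skeinClass (unknot true)} := by
  induction k with
  | zero =>
    rw [closureClass_one_strand]
    exact Submodule.mem_span_singleton_self _
  | succ k ih =>
    rw [← Submodule.Quotient.mk_eq_zero]
    -- The spanning principle is applied to the closure class modulo the multiples of the unknot.
    refine eq_zero_of_shift z (fun β => Submodule.Quotient.mk (p :=
      Submodule.span Poly {skeinClass (unknot true)}) (closureClass β)) ?_ ?_ ?_ β
    · intro i x y
      rw [← Submodule.Quotient.mk_sub, closureClass_skein, Submodule.Quotient.mk_smul]
    · intro x
      rw [Submodule.Quotient.mk_eq_zero]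
      have h := Submodule.smul_mem _ (LaurentPolynomial.C (LaurentPolynomial.T (-1)) *
        (v (-1) - v 1)) (ih x)
      rwa [mul_smul, ← z_smul_closureClass_shift, ← mul_smul, z_mul_inv, one_smul] at h
    · intro x y
      rw [Submodule.Quotient.mk_eq_zero, closureClass_shift]
      exact Submodule.smul_mem _ _ (ih _)

/-- The framed Homfly polynomial of the closure of a braid. -/
noncomputable def braidHomfly {k : ℕ} (β : BraidGroup (k + 1)) : Poly :=
  (Submodule.mem_span_singleton.1 (closureClass_mem_span k β)).choose

theorem braidHomfly_smul {k : ℕ} (β : BraidGroup (k + 1)) :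
    braidHomfly β • skeinClass (unknot true) = closureClass β :=
  (Submodule.mem_span_singleton.1 (closureClass_mem_span k β)).choose_spec

theorem smul_unknot_injective {p q : Poly}
    (h : p • skeinClass (unknot true) = q • skeinClass (unknot true)) : p = q := by
  rw [← sub_eq_zero, ← sub_smul] at h
  exact sub_eq_zero.1 (eq_zero_of_smul_unknot h)

theorem isFramedHomfly_iff {k : ℕ} (w : BraidWord (k + 1)) (h : Poly) :
    IsFramedHomfly w.closure h ↔ h = braidHomfly w.toBraid := by
  rw [IsFramedHomfly, ← closureClass_toBraid, ← braidHomfly_smul]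
  exact ⟨fun e => (smul_unknot_injective e).symm, fun e => by rw [e]⟩

theorem framedHomfly_closure {k : ℕ} (w : BraidWord (k + 1)) :
    framedHomfly w.closure = braidHomfly w.toBraid := by
  have h : ∃ p, IsFramedHomfly w.closure p := ⟨_, (isFramedHomfly_iff w _).2 rfl⟩
  rw [framedHomfly, dif_pos h]
  exact (isFramedHomfly_iff w _).1 h.choose_spec

theorem braidHomfly_skein {k : ℕ} (i : Fin (k + 1 - 1)) (x y : BraidGroup (k + 1)) :
    braidHomfly (x * sigma i * y) - braidHomfly (x * (sigma i)⁻¹ * y) =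
      z * braidHomfly (x * y) := by
  apply smul_unknot_injective
  rw [sub_smul, mul_smul]
  simp only [braidHomfly_smul]
  exact closureClass_skein i x y

theorem braidHomfly_shift {k : ℕ} (x y : BraidGroup (k + 1)) :
    braidHomfly (shiftHom k x * gen (k + 1) 0 * shiftHom k y) =
      v (-1) * braidHomfly (x * y) := by
  apply smul_unknot_injective
  rw [mul_smul]
  simp only [braidHomfly_smul]
  exact closureClass_shift x y

theorem braidHomfly_shift_inv {k : ℕ} (x y : BraidGroup (k + 1)) :
    braidHomfly (shiftHom k x * (gen (k + 1) 0)⁻¹ * shiftHom k y) =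
      v 1 * braidHomfly (x * y) := by
  apply smul_unknot_injective
  rw [mul_smul]
  simp only [braidHomfly_smul]
  exact closureClass_shift_inv x y

theorem z_mul_braidHomfly_shift {k : ℕ} (x : BraidGroup (k + 1)) :
    z * braidHomfly (shiftHom k x) = (v (-1) - v 1) * braidHomfly x := by
  apply smul_unknot_injective
  rw [mul_smul, mul_smul]
  simp only [braidHomfly_smul]
  exact z_smul_closureClass_shift x

/-! ## The extreme coefficients -/

theorem coeff_v_mul (k : ℤ) (p : Poly) (n : ℤ) : (v k * p).coeff n = p.coeff (n - k) :=
  coeff_T_mul k p n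

theorem coeff_z_mul (p : Poly) (n : ℤ) :
    (z * p).coeff n = LaurentPolynomial.T 1 * p.coeff n := by
  rw [z, ← LaurentPolynomial.smul_eq_C_mul]
  rfl

theorem coeff_sub_poly (p q : Poly) (n : ℤ) : (p - q).coeff n = p.coeff n - q.coeff n := rfl

theorem T_one_mul_cancel {p q : LaurentPolynomial ℤ}
    (h : LaurentPolynomial.T 1 * p = LaurentPolynomial.T 1 * q) : p = q :=
  (LaurentPolynomial.isUnit_T 1).mul_left_cancel h

theorem coeff_braidHomfly_skein {k : ℕ} (n : ℤ) (i : Fin (k + 1 - 1)) (x y : BraidGroup (k + 1)) :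
    (braidHomfly (x * sigma i * y)).coeff n - (braidHomfly (x * (sigma i)⁻¹ * y)).coeff n =
      LaurentPolynomial.T 1 * (braidHomfly (x * y)).coeff n := by
  rw [← coeff_sub_poly, braidHomfly_skein, coeff_z_mul]

theorem coeff_braidHomfly_shift {k : ℕ} (n : ℤ) (x : BraidGroup (k + 1)) :
    LaurentPolynomial.T 1 * (braidHomfly (shiftHom k x)).coeff n =
      (braidHomfly x).coeff (n + 1) - (braidHomfly x).coeff (n - 1) := by
  rw [← coeff_z_mul, z_mul_braidHomfly_shift, sub_mul, coeff_sub_poly, coeff_v_mul, coeff_v_mul,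
    sub_neg_eq_add]

theorem braidHomfly_one_strand (β : BraidGroup (0 + 1)) : braidHomfly β = 1 := by
  apply smul_unknot_injective
  rw [braidHomfly_smul, one_smul]
  exact closureClass_one_strand β

/-- The degree bounds of Morton and Franks–Williams. -/
theorem coeff_braidHomfly_eq_zero {k : ℕ} (β : BraidGroup (k + 1)) {n : ℤ} (hn : (k : ℤ) < |n|) :
    (braidHomfly β).coeff n = 0 := by
  induction k generalizing n with
  | zero =>
    have : (0 : ℤ) ≠ n := by
      rintro rfl
      simp at hn
    rw [braidHomfly_one_strand, ← LaurentPolynomial.T_zero, LaurentPolynomial.T_apply, if_neg this]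
  | succ k ih =>
    have h1 : (k : ℤ) < |n + 1| := by
      have := abs_sub_abs_le_abs_sub n (-1)
      simp only [abs_neg, abs_one, sub_neg_eq_add] at this
      push_cast at hn
      omega
    have h2 : (k : ℤ) < |n - 1| := by
      have := abs_sub_abs_le_abs_sub n 1
      simp only [abs_one] at this
      push_cast at hn
      omega
    -- A fixed coefficient in v is again a Hecke function. Adding a strand shifts exponents of v by
    -- at most one, whence the bounds `h1` and `h2`.
    refine eq_zero_of_shift (LaurentPolynomial.T 1 : LaurentPolynomial ℤ)
      (fun β => (braidHomfly β).coeff n) (fun i x y => coeff_braidHomfly_skein n i x y)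
      (fun x => ?_) (fun x y => ?_) β
    · apply T_one_mul_cancel
      rw [coeff_braidHomfly_shift, ih x h1, ih x h2, sub_zero, mul_zero]
    · rw [braidHomfly_shift, coeff_v_mul, sub_neg_eq_add, ih _ h1]

/-- The kink contributes v⁻¹, so a term v^{k+1} would come from v^{k+2} on k + 1 strands, beyond the
degree bound. -/
theorem coeff_top_shift {k : ℕ} (x y : BraidGroup (k + 1)) :
    (braidHomfly (shiftHom k x * gen (k + 1) 0 * shiftHom k y)).coeff ((k + 1 : ℕ) : ℤ) = 0 := by
  rw [braidHomfly_shift, coeff_v_mul]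
  refine coeff_braidHomfly_eq_zero _ ?_
  rw [abs_of_nonneg (by omega)]
  omega

theorem coeff_bottom_shift_inv {k : ℕ} (x y : BraidGroup (k + 1)) :
    (braidHomfly (shiftHom k x * (gen (k + 1) 0)⁻¹ * shiftHom k y)).coeff (-((k + 1 : ℕ) : ℤ)) =
      0 := by
  rw [braidHomfly_shift_inv, coeff_v_mul]
  refine coeff_braidHomfly_eq_zero _ ?_
  rw [abs_of_nonpos (by omega)]
  omega

theorem shiftHom_seq (k : ℕ) :
    (fun i => shiftHom k (gen k i)) = fun i => gen (k + 1) (i + 1) :=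
  funext fun i => shiftHom_gen k i

/-- The top coefficient does not change when the added strand is pulled once around the first `j`
strands. -/
theorem coeff_top_ascProd_mul_descProd {k : ℕ} (a : BraidGroup (k + 1)) {j : ℕ} (hj : j ≤ k + 1) :
    (braidHomfly (shiftHom k a * (ascProd (gen (k + 1)) j * descProd (gen (k + 1)) j))).coeff
      ((k + 1 : ℕ) : ℤ) = (braidHomfly (shiftHom k a)).coeff ((k + 1 : ℕ) : ℤ) := by
  induction j with
  | zero => simp [ascProd, descProd]
  | succ j ih =>
    have hF : IsHeckeFunction (LaurentPolynomial.T 1 : LaurentPolynomial ℤ) (gen (k + 1)) (k + 1)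
        fun β => (braidHomfly β).coeff ((k + 1 : ℕ) : ℤ) := by
      intro i hi x y
      have := coeff_braidHomfly_skein (k := k + 1) ((k + 1 : ℕ) : ℤ) ⟨i, hi⟩ x y
      rwa [← gen_val] at this
    -- The innermost square in the product for `j + 1` is resolved: one term is the product for `j`,
    -- and the other is z times a braid that `h2` rewrites with a single σ₁, so that
    -- `coeff_top_shift` kills it.
    have h1 := hF.map_sq (i := j) (by omega) (shiftHom k a * ascProd (gen (k + 1)) j)
      (descProd (gen (k + 1)) j)
    have h2 : shiftHom k a * ascProd (gen (k + 1)) j * gen (k + 1) j * descProd (gen (k + 1)) j =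
        shiftHom k (a * descProd (gen k) j) * gen (k + 1) 0 * shiftHom k (ascProd (gen k) j) := by
      rw [map_mul, descProd_map, ascProd_map, shiftHom_seq]
      have := (isBraidSequence_gen (k + 1)).ascProd_mul_mul_descProd (m := j) (by omega)
      simp only [mul_assoc] at this ⊢
      rw [this]
    rw [h2, coeff_top_shift, smul_zero, add_zero, mul_assoc (shiftHom k a) _ (descProd _ _),
      ih (by omega)] at h1
    rw [← h1]
    simp only [ascProd, descProd, mul_assoc]

theorem commute_shiftHom {k : ℕ} (x : BraidGroup (k + 1)) :
    Commute (shiftHom k x) (ascProd (gen (k + 1)) (k + 1) * descProd (gen (k + 1)) (k + 1)) := by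
  let A := ascProd (gen (k + 1)) (k + 1) * descProd (gen (k + 1)) (k + 1)
  have : x ∈ (Subgroup.centralizer {A}).comap (shiftHom k) := by
    refine PresentedGroup.generated_by _ _ (fun i => ?_) x
    rw [Subgroup.mem_comap, Subgroup.mem_centralizer_singleton_iff]
    have hi := i.isLt
    have h := (isBraidSequence_gen (k + 1)).commute_ascProd_mul_descProd le_rfl (i := i.val)
      (by omega)
    have e := shiftHom_sigma i
    rw [sigma] at e
    rw [e]
    exact h.eq
  rw [Subgroup.mem_comap, Subgroup.mem_centralizer_singleton_iff] at this
  exact this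

/-- The full twist moves the bottom coefficient to the top. -/
theorem coeff_braidHomfly_mul_fullTwist {k : ℕ} (β : BraidGroup (k + 1)) :
    (braidHomfly β).coeff (-(k : ℤ)) =
      (-1) ^ k * (braidHomfly (β * halfTwist (gen k) (k + 1) ^ 2)).coeff (k : ℤ) := by
  induction k with
  | zero => simp [braidHomfly_one_strand]
  | succ k ih =>
    set δ := halfTwist (gen k) (k + 1) with hδ
    set A := ascProd (gen (k + 1)) (k + 1) * descProd (gen (k + 1)) (k + 1) with hA
    have hΔ : halfTwist (gen (k + 1)) (k + 2) ^ 2 = shiftHom k δ * A * shiftHom k δ := by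
      rw [(isBraidSequence_gen (k + 1)).halfTwist_sq le_rfl, hδ, halfTwist_map, shiftHom_seq]
    have hcomm : ∀ x, Commute (shiftHom k x) A := commute_shiftHom
    rw [hΔ, ← sub_eq_zero]
    let F : BraidGroup (k + 2) → LaurentPolynomial ℤ := fun β =>
      (braidHomfly β).coeff (-((k + 1 : ℕ) : ℤ)) - (-1) ^ (k + 1) *
        (braidHomfly (β * (shiftHom k δ * A * shiftHom k δ))).coeff ((k + 1 : ℕ) : ℤ)
    have hecke : ∀ (i : Fin (k + 2 - 1)) x y, F (x * sigma i * y) - F (x * (sigma i)⁻¹ * y) =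
        (LaurentPolynomial.T 1 : LaurentPolynomial ℤ) • F (x * y) := by
      intro i x y
      have h1 := coeff_braidHomfly_skein (k := k + 1) (-((k + 1 : ℕ) : ℤ)) i x y
      have h2 := coeff_braidHomfly_skein (k := k + 1) ((k + 1 : ℕ) : ℤ) i x
        (y * (shiftHom k δ * A * shiftHom k δ))
      simp only [← mul_assoc] at h2
      simp only [F, smul_eq_mul, ← mul_assoc]
      linear_combination h1 - (-1) ^ (k + 1) * h2
    have low : ∀ x, F (shiftHom k x) = 0 := by
      intro x
      have e : shiftHom k x * (shiftHom k δ * A * shiftHom k δ) = shiftHom k (x * δ ^ 2) * A := by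
        rw [sq, map_mul, map_mul, mul_assoc (shiftHom k δ), ← (hcomm δ).eq]
        simp only [mul_assoc]
      apply T_one_mul_cancel
      -- In the loop factor v⁻¹ - v the bottom coefficient sees v⁻¹ and the top coefficient sees -v;
      -- this yields one more sign. The other term is excluded by the degree bound in each case.
      have h1 := coeff_braidHomfly_shift (-((k + 1 : ℕ) : ℤ)) x
      have h2 := coeff_braidHomfly_shift ((k + 1 : ℕ) : ℤ) (x * δ ^ 2)
      rw [coeff_braidHomfly_eq_zero x (n := -((k + 1 : ℕ) : ℤ) - 1)
        (by rw [abs_of_nonpos (by omega)]; omega),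
        show -((k + 1 : ℕ) : ℤ) + 1 = -(k : ℤ) by omega, ih] at h1
      rw [coeff_braidHomfly_eq_zero (x * δ ^ 2) (n := ((k + 1 : ℕ) : ℤ) + 1)
        (by rw [abs_of_nonneg (by omega)]; omega),
        show ((k + 1 : ℕ) : ℤ) - 1 = (k : ℤ) by omega] at h2
      simp only [F]
      rw [e, hA, coeff_top_ascProd_mul_descProd _ le_rfl]
      linear_combination h1 - (-1) ^ (k + 1) * h2
    -- The inverse letter is used here because the bottom coefficient vanishes for σ₁⁻¹, and the
    -- full twist converts σ₁⁻¹ to σ₁, for which the top coefficient vanishes.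
    have high_inv : ∀ x y, F (shiftHom k x * (gen (k + 1) 0)⁻¹ * shiftHom k y) = 0 := by
      intro x y
      have e : shiftHom k x * (gen (k + 1) 0)⁻¹ * shiftHom k y *
          (shiftHom k δ * A * shiftHom k δ) =
          shiftHom k (x * (ascProd (gen k) k * descProd (gen k) k)) * gen (k + 1) 0 *
            shiftHom k (y * δ * δ) := by
        -- The first letter of A cancels and its last letter remains; everything between avoids σ₁.
        have h1 : (gen (k + 1) 0)⁻¹ * A =
            shiftHom k (ascProd (gen k) k * descProd (gen k) k) * gen (k + 1) 0 := by
          rw [hA, ascProd_succ', descProd_succ', map_mul, ascProd_map, descProd_map, shiftHom_seq]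
          group
        calc _ = shiftHom k x * (gen (k + 1) 0)⁻¹ * (shiftHom k (y * δ) * A) * shiftHom k δ := by
              rw [map_mul]; group
          _ = shiftHom k x * ((gen (k + 1) 0)⁻¹ * A) * (shiftHom k (y * δ) * shiftHom k δ) := by
              rw [(hcomm (y * δ)).eq]; group
          _ = _ := by
              rw [h1, ← map_mul, map_mul _ x]; group
      simp only [F]
      rw [e, coeff_top_shift, coeff_bottom_shift_inv, mul_zero, sub_zero]
    refine eq_zero_of_shift (LaurentPolynomial.T 1 : LaurentPolynomial ℤ) F hecke low
      (fun x y => ?_) β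
    -- The Hecke relation passes from σ₁⁻¹ to σ₁, since the smoothed term falls under `low`.
    have h := hecke ⟨0, by omega⟩ (shiftHom k x) (shiftHom k y)
    rw [← gen_val, high_inv, ← map_mul, low, smul_zero, sub_zero] at h
    exact h

end FramedHomfly

theorem mainTheorem3 (n : ℕ) (hn : 1 ≤ n) (β : FramedHomfly.BraidGroup n)
    (w w' : FramedHomfly.BraidWord n) (hw : w.toBraid = β)
    (hw' : w'.toBraid = β * FramedHomfly.garside n ^ 2) :
    (∃! h, FramedHomfly.IsFramedHomfly w.closure h) ∧
    (∃! h, FramedHomfly.IsFramedHomfly w'.closure h) ∧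
    (FramedHomfly.framedHomfly w.closure).coeff (-(n : ℤ) + 1) =
      (-1) ^ (n - 1) * (FramedHomfly.framedHomfly w'.closure).coeff ((n : ℤ) - 1) := by
  obtain ⟨k, rfl⟩ : ∃ k, n = k + 1 := ⟨n - 1, by omega⟩
  refine ⟨⟨_, (FramedHomfly.isFramedHomfly_iff w _).2 rfl,
    fun h hh => (FramedHomfly.isFramedHomfly_iff w h).1 hh⟩,
    ⟨_, (FramedHomfly.isFramedHomfly_iff w' _).2 rfl,
    fun h hh => (FramedHomfly.isFramedHomfly_iff w' h).1 hh⟩, ?_⟩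
  rw [FramedHomfly.framedHomfly_closure, FramedHomfly.framedHomfly_closure, hw, hw',
    FramedHomfly.garside_eq, show -((k + 1 : ℕ) : ℤ) + 1 = -(k : ℤ) by omega,
    show ((k + 1 : ℕ) : ℤ) - 1 = (k : ℤ) by omega]
  exact FramedHomfly.coeff_braidHomfly_mul_fullTwist β
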